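/- Let $\Omega=\mathbb P^1(\mathbb F_{23})$, let $S(5,8,24)$ be the $\mathrm{PSL}_2(23)$-orbit of $\{\infty,0,1,3,12,15,21,22\}$ (its members are called octads), and let $\mathcal C\subset\mathbb F_2^{\Omega}$ be the binary Golay code spanned by the octads. The (negative definite) Leech lattice $\Lambda$ consists of all $\xi\in\mathbb Z^{\Omega}$ such that, for some $m\in\mathbb Z$: all $\xi_i\equiv m \pmod 2$; for every $n$ the set $\{i:\xi_i\equiv n \pmod 4\}$ is the support of a word of $\mathcal C$; and $\sum_i\xi_i\equiv 4m\pmod 8$. Its form is $\langle\xi,\eta\rangle=-\frac18\sum_i\xi_i\eta_i$. Let $I\!I_{1,25}=U\oplus\Lambda$, with vectors $(m,n;\lambda)$ and $\langle (m,n;\lambda),(m',n';\lambda')\rangle=mn'+m'n+\langle\lambda,\lambda'\rangle$. A Leech root is a vector $(-\lambda^2/2-1,1;\lambda)$ with $\lambda\in\Lambda$. For $S\subseteq\Omega$ let $\nu_S$ be its indicator vector, write $\nu_k=\nu_{\{k\}}$, and let $K_0=\{0,2,3,4,5,15,20,22\}$. Let $y,z,x,p,q,t$ be the Leech roots belonging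 to $$4\nu_0+\nu_\Omega,\quad 0,\quad 4\nu_\infty+\nu_\Omega,\quad 2\nu_{K_0},\quad 4\nu_\infty+4\nu_0,\quad \nu_\Omega-4\nu_1$$ respectively; in this order they form a Dynkin diagram $A_6$, and they generate a root lattice denoted $A_6$. Let $S_X=A_6^{\perp}$ in $I\!I_{1,25}$ (a copy of the Néron–Severi lattice of the singular $K3$ surface of discriminant $7$), and let $r\mapsto r'$ be the orthogonal projection to $(S_X)_{\mathbb R}$. Let $P$ be the component of $\{v\in (I\!I_{1,25})_{\mathbb R}: v^2>0\}$ with $(1,0;0)$ in its closure, let $D=\{v\in P:\langle v,r\rangle>0\text{ for all Leech roots } r\}$, and let $D'$ be the intersection of the closure of $D$ in $P$ with $(S_X)_{\mathbb R}$. A face of $D'$ means a face of codimension one, i.e. an exposed face whose linear span has dimension one less than the linear span of $D'$. A root lattice is a negative definite integral lattice generated by vectors of norm $-2$. **Proposition.** (1) Let $r$ be a Leech root such that $A_6$ and $r$ together generate a root lattice $R$ of rank $7$. Then $R$ is of type $A_6\oplus A_1$, $A_7$, $D_7$ or $E_7$. (2) The numbers of Leech roots $r$ for which $R$ has type $A_6\oplus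 A_1$, $A_7$, $D_7$, $E_7$ are exactly $28$, $14$, $28$, $56$, respectively. (3) The map $r\mapsto D'\cap (r')^{\perp}$ is a bijection from the set of Leech roots $r$ in (1) onto the set of faces of $D'$. (4) If $R$ has type $A_6\oplus A_1$, $A_7$, $D_7$ or $E_7$, then $\langle r',r'\rangle$ equals $-2$, $-8/7$, $-4/7$ or $-2/7$, respectively. -/

import Mathlib

open scoped MatrixGroups

noncomputable section

namespace LeechA6

/-! ### The Steiner system `S(5,8,24)` and the binary Golay code -/

instance factPrime23 : Fact (Nat.Prime 23) := ⟨by norm_num⟩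

/-- The projective line over the field with 23 elements. -/
abbrev Omega : Type := OnePoint (ZMod 23)

instance decEqOmega : DecidableEq Omega := inferInstanceAs (DecidableEq (Option (ZMod 23)))

/-- The point at infinity of the projective line. -/
abbrev inf : Omega := OnePoint.infty

/-- The point of the projective line given by an element of the field. -/
abbrev pt (k : ZMod 23) : Omega := (k : OnePoint (ZMod 23))

/-- The action of `SL(2, 23)` on the projective line by Moebius transformations. -/
def moebius (g : SL(2, ZMod 23)) (i : Omega) : Omega := (g : GL (Fin 2) (ZMod 23)) • i

lemma moebius_inf (g : SL(2, ZMod 23)) :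
    moebius g inf = if g 1 0 = 0 then inf else pt (g 0 0 / g 1 0) := by
  unfold moebius
  rw [OnePoint.smul_infty_eq_ite]
  rfl

lemma moebius_pt (g : SL(2, ZMod 23)) (k : ZMod 23) :
    moebius g (pt k) = if g 1 0 * k + g 1 1 = 0 then inf
      else pt ((g 0 0 * k + g 0 1) / (g 1 0 * k + g 1 1)) := by
  unfold moebius
  rw [OnePoint.smul_some_eq_ite]
  rfl

/-- The octad `{∞, 0, 1, 3, 12, 15, 21, 22}`. -/
def baseOctad : Finset Omega := {inf, pt 0, pt 1, pt 3, pt 12, pt 15, pt 21, pt 22}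

/-- The Steiner system `S(5,8,24)`: the `PSL(2, 23)`-orbit of the base octad. -/
def octads : Set (Finset Omega) := {K | ∃ g : SL(2, ZMod 23), K = baseOctad.image (moebius g)}

/-- The binary Golay code, spanned over the field with two elements by the octads. -/
def golay : Submodule (ZMod 2) (Omega → ZMod 2) :=
  Submodule.span (ZMod 2) {c | ∃ K ∈ octads, c = fun i => if i ∈ K then 1 else 0}

/-- A `C`-set: the support of a word of the Golay code. -/
def IsCSet (S : Set Omega) : Prop := ∃ c ∈ golay, S = Function.support c

/-! ### The Leech lattice -/

/-- The conditions defining the Leech lattice inside the integral vectors. -/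
def IsLeechVector (ξ : Omega → ℤ) : Prop :=
  ∃ m : ℤ, (∀ i, ξ i ≡ m [ZMOD 2]) ∧ (∀ n : ℤ, IsCSet {i | ξ i ≡ n [ZMOD 4]}) ∧
    ∑ i, ξ i ≡ 4 * m [ZMOD 8]

lemma div_eq_mul_pow (x y : ZMod 23) : x / y = x * y ^ 21 := by
  rw [div_eq_mul_inv]
  congr 1
  by_cases hy : y = 0
  · simp [hy]
  · have h : y ^ 22 = 1 := ZMod.pow_card_sub_one_eq_one hy
    exact inv_eq_of_mul_eq_one_right (by rw [← pow_succ', h])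

lemma mem_octads_of_matrix (a b c d : ZMod 23) (h : a * d - b * c = 1) :
    baseOctad.image (fun i : Omega => i.elim (if c = 0 then inf else pt (a * c ^ 21))
      (fun k => if c * k + d = 0 then inf else pt ((a * k + b) * (c * k + d) ^ 21))) ∈ octads := by
  refine ⟨⟨!![a, b; c, d], by rw [Matrix.det_fin_two_of, h]⟩, ?_⟩
  congr 1
  funext i
  induction i using OnePoint.rec with
  | infty =>
    have e := moebius_inf ⟨!![a, b; c, d], by rw [Matrix.det_fin_two_of, h]⟩
    rw [div_eq_mul_pow] at e
    exact e.symm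
  | coe k =>
    have e := moebius_pt ⟨!![a, b; c, d], by rw [Matrix.det_fin_two_of, h]⟩ k
    rw [div_eq_mul_pow] at e
    exact e.symm

lemma octad_one : baseOctad ∈ octads := ⟨1, by
  have : moebius 1 = id := by funext i; simp [moebius]
  simp [this]⟩

lemma octad_two :
    ({pt 2, pt 4, pt 5, pt 6, pt 13, pt 16, pt 18, pt 20} : Finset Omega) ∈ octads := by
  convert mem_octads_of_matrix 21 13 18 9 (by decide) using 1
  decide

lemma octad_three :
    ({pt 7, pt 8, pt 9, pt 10, pt 11, pt 14, pt 17, pt 19} : Finset Omega) ∈ octads := by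
  convert mem_octads_of_matrix 11 10 3 7 (by decide) using 1
  decide

lemma golay_octad {K : Finset Omega} (hK : K ∈ octads) :
    (fun i => if i ∈ K then 1 else 0 : Omega → ZMod 2) ∈ golay :=
  Submodule.subset_span ⟨K, hK, rfl⟩

lemma golay_one : (fun _ => 1 : Omega → ZMod 2) ∈ golay := by
  convert golay.add_mem (golay.add_mem (golay_octad octad_one) (golay_octad octad_two))
    (golay_octad octad_three) using 1
  decide

/-- For a vector with all entries of one parity, one residue class modulo `4` decides the
condition on the residue classes modulo `4`. -/
lemma forall_isCSet_iff {ξ : Omega → ℤ} {m : ℤ} (hm : ∀ i, ξ i ≡ m [ZMOD 2]) :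
    (∀ n : ℤ, IsCSet {i | ξ i ≡ n [ZMOD 4]}) ↔ IsCSet {i | ξ i ≡ m + 2 [ZMOD 4]} := by
  refine ⟨fun h => h _, ?_⟩
  rintro ⟨c, hc, hS⟩ n
  have hmem : ∀ i, ξ i ≡ m + 2 [ZMOD 4] ↔ c i ≠ 0 := fun i => by
    have := Set.ext_iff.1 hS i
    simpa using this
  rcases (by omega : (n - m) % 4 = 0 ∨ (n - m) % 4 = 2 ∨ (n - m) % 2 = 1) with h | h | h
  · refine ⟨c + fun _ => 1, golay.add_mem hc golay_one, ?_⟩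
    ext i
    have h1 := hm i
    have h2 := hmem i
    have h3 : ∀ x : ZMod 2, x + 1 ≠ 0 ↔ ¬ x ≠ 0 := by decide
    simp only [Set.mem_ofPred_eq, Function.mem_support, Pi.add_apply, h3, ← h2]
    simp only [Int.ModEq] at h1 ⊢
    omega
  · refine ⟨c, hc, ?_⟩
    ext i
    have h2 := hmem i
    simp only [Set.mem_ofPred_eq, Function.mem_support, ← h2, Int.ModEq]
    omega
  · refine ⟨0, golay.zero_mem, ?_⟩
    ext i
    have h1 := hm i
    simp only [Set.mem_ofPred_eq, Function.mem_support, Pi.zero_apply, ne_eq, not_true_eq_false,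
      iff_false]
    simp only [Int.ModEq] at h1 ⊢
    omega

/-- The Leech lattice, as a subgroup of the group of integral vectors. -/
def leech : AddSubgroup (Omega → ℤ) where
  carrier := {ξ | IsLeechVector ξ}
  zero_mem' := by
    refine ⟨0, fun i => rfl, ?_, by simp⟩
    refine (forall_isCSet_iff (ξ := 0) (m := 0) (fun i => rfl)).2 ?_
    refine ⟨0, golay.zero_mem, ?_⟩
    ext i
    simp [Int.ModEq]
  add_mem' := by
    rintro ξ η ⟨m, hm, hc, hs⟩ ⟨m', hm', hc', hs'⟩
    have hmm : ∀ i, (ξ + η) i ≡ m + m' [ZMOD 2] := fun i => (hm i).add (hm' i)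
    refine ⟨m + m', hmm, ?_, ?_⟩
    · rw [forall_isCSet_iff hmm]
      obtain ⟨c, hc, hS⟩ := hc (m + 2)
      obtain ⟨c', hc', hS'⟩ := hc' (m' + 2)
      refine ⟨c + c', golay.add_mem hc hc', ?_⟩
      ext i
      have h1 := Set.ext_iff.1 hS i
      have h2 := Set.ext_iff.1 hS' i
      have h3 := hm i
      have h4 := hm' i
      have h5 : ∀ x y : ZMod 2, x + y ≠ 0 ↔ ((x ≠ 0 ∧ ¬ y ≠ 0) ∨ (¬ x ≠ 0 ∧ y ≠ 0)) := by decide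
      simp only [Set.mem_ofPred_eq, Function.mem_support] at h1 h2
      simp only [Set.mem_ofPred_eq, Function.mem_support, Pi.add_apply, h5, ← h1, ← h2]
      simp only [Int.ModEq] at h3 h4 ⊢
      omega
    · simp only [Pi.add_apply, Finset.sum_add_distrib, mul_add]
      exact hs.add hs'
  neg_mem' := by
    rintro ξ ⟨m, hm, hc, hs⟩
    have hmm : ∀ i, (-ξ) i ≡ -m [ZMOD 2] := fun i => (hm i).neg
    refine ⟨-m, hmm, ?_, ?_⟩
    · rw [forall_isCSet_iff hmm]
      obtain ⟨c, hc, hS⟩ := hc (m + 2)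
      refine ⟨c, hc, ?_⟩
      ext i
      have h1 := Set.ext_iff.1 hS i
      simp only [Set.mem_ofPred_eq, Function.mem_support] at h1
      simp only [Set.mem_ofPred_eq, Function.mem_support, Pi.neg_apply, ← h1]
      simp only [Int.ModEq]
      omega
    · simp only [Pi.neg_apply, Finset.sum_neg_distrib, mul_neg]
      exact hs.neg

/-! ### The lattice `II_{1,25}` and its Leech roots -/

/-- The real vector space spanned by `II_{1,25} = U ⊕ Λ`; its vectors are written `(m, n, v)`. -/
abbrev V : Type := ℝ × ℝ × (Omega → ℝ)

/-- The bilinear form on `V`: hyperbolic plane plus the negative definite form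
`-(∑ ξ_i η_i) / 8` of the Leech lattice. -/
def form : LinearMap.BilinForm ℝ V :=
  LinearMap.mk₂ ℝ
    (fun v w => v.1 * w.2.1 + v.2.1 * w.1 - (∑ i, v.2.2 i * w.2.2 i) / 8)
    (by intro u v w; simp [add_mul, Finset.sum_add_distrib]; ring)
    (by intro c v w; simp [mul_assoc, ← Finset.mul_sum]; ring)
    (by intro u v w; simp [mul_add, Finset.sum_add_distrib]; ring)
    (by intro c v w; simp [mul_left_comm, ← Finset.mul_sum]; ring)

lemma form_apply (v w : V) :
    form v w = v.1 * w.2.1 + v.2.1 * w.1 - (∑ i, v.2.2 i * w.2.2 i) / 8 := rfl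

lemma form_comm (v w : V) : form v w = form w v := by
  simp only [form_apply, mul_comm]
  ring

lemma form_isRefl : form.IsRefl := fun v w h => by rw [form_comm, h]

/-- An integral vector, viewed in the real vector space. -/
def toReal (ξ : Omega → ℤ) : Omega → ℝ := fun i => (ξ i : ℝ)

/-- The even unimodular lattice `II_{1,25} = U ⊕ Λ`. -/
def II125 : Submodule ℤ V where
  carrier := {v | ∃ m n : ℤ, ∃ ξ ∈ leech, v = ((m : ℝ), (n : ℝ), toReal ξ)}
  zero_mem' := ⟨0, 0, 0, leech.zero_mem, by ext <;> simp [toReal]⟩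
  add_mem' := by
    rintro _ _ ⟨m, n, ξ, hξ, rfl⟩ ⟨m', n', ξ', hξ', rfl⟩
    exact ⟨m + m', n + n', ξ + ξ', leech.add_mem hξ hξ', by ext <;> simp [toReal]⟩
  smul_mem' := by
    rintro k _ ⟨m, n, ξ, hξ, rfl⟩
    exact ⟨k * m, k * n, k • ξ, leech.zsmul_mem hξ k, by ext <;> simp [toReal]⟩

/-- The vector `(-λ²/2 - 1, 1; λ)`, where `λ² = -(∑ ξ_i²) / 8`. -/
def leechRoot (ξ : Omega → ℤ) : V :=
  ((∑ i, (ξ i : ℝ) ^ 2) / 16 - 1, 1, toReal ξ)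

/-- A Leech root: a vector of `II_{1,25}` of the form `(-λ²/2 - 1, 1; λ)` with `λ` in the
Leech lattice. -/
def IsLeechRoot (r : V) : Prop := r ∈ II125 ∧ ∃ ξ ∈ leech, r = leechRoot ξ

/-! ### The fixed root lattice `A₆` -/

/-- For a subset of the projective line, the vector with entries `1` on it and `0` elsewhere. -/
def nu (S : Finset Omega) : Omega → ℤ := fun i => if i ∈ S then 1 else 0

/-- The octad `{0, 2, 3, 4, 5, 15, 20, 22}`. -/
def K0 : Finset Omega := {pt 0, pt 2, pt 3, pt 4, pt 5, pt 15, pt 20, pt 22}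

/-- The Leech lattice vectors `Y, Z, X, P, Q, T`. -/
def a6Vector : Fin 6 → Omega → ℤ :=
  ![4 • nu {pt 0} + nu Finset.univ,
    0,
    4 • nu {inf} + nu Finset.univ,
    2 • nu K0,
    4 • nu {inf} + 4 • nu {pt 0},
    nu Finset.univ - 4 • nu {pt 1}]

/-- The six Leech roots `y, z, x, p, q, t`. -/
def a6Root (j : Fin 6) : V := leechRoot (a6Vector j)

lemma form_leechRoot (ξ η : Omega → ℤ) :
    form (leechRoot ξ) (leechRoot η) = ((∑ i, (ξ i - η i) ^ 2 : ℤ) : ℝ) / 16 - 2 := by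
  have h : ((∑ i, (ξ i - η i) ^ 2 : ℤ) : ℝ)
      = ∑ i, (ξ i : ℝ) ^ 2 + ∑ i, (η i : ℝ) ^ 2 - 2 * ∑ i, (ξ i : ℝ) * (η i : ℝ) := by
    rw [Finset.mul_sum, ← Finset.sum_add_distrib, ← Finset.sum_sub_distrib]
    push_cast
    exact Finset.sum_congr rfl fun i _ => by ring
  rw [h]
  simp only [form_apply, leechRoot, toReal]
  ring

lemma a6_sum (j k : Fin 6) :
    ∑ i, (a6Vector j i - a6Vector k i) ^ 2 = 16 * (2 - CartanMatrix.A 6 j k) := by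
  revert j k
  decide

/-- The six roots `y, z, x, p, q, t` form, in this order, an `A₆` diagram. -/
lemma form_a6Root (j k : Fin 6) :
    form (a6Root j) (a6Root k) = -((CartanMatrix.A 6 j k : ℤ) : ℝ) := by
  rw [a6Root, a6Root, form_leechRoot, a6_sum]
  push_cast
  ring

/-- The real span of the root lattice `A₆`. -/
def a6Span : Submodule ℝ V := Submodule.span ℝ (Set.range a6Root)

/-- The orthogonal complement of `A₆` in `V`: the real span of `S_X = A₆^⊥`. -/
def a6Perp : Submodule ℝ V := form.orthogonal a6Span

lemma isCompl_a6 : IsCompl a6Perp a6Span := by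
  refine IsCompl.symm ?_
  rw [a6Perp, LinearMap.BilinForm.isCompl_orthogonal_iff_disjoint form_isRefl,
    Submodule.disjoint_def]
  intro v hv hv'
  rw [a6Span, Submodule.mem_span_range_iff_exists_fun] at hv
  obtain ⟨c, rfl⟩ := hv
  have h : ∀ j, ∑ k, c k * ((CartanMatrix.A 6 j k : ℤ) : ℝ) = 0 := fun j => by
    have := hv' (a6Root j) (Submodule.subset_span ⟨j, rfl⟩)
    simp only [map_sum, map_smul, form_a6Root, smul_eq_mul,
      mul_neg, Finset.sum_neg_distrib, neg_eq_zero] at this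
    exact this
  have h0 := h 0
  have h1 := h 1
  have h2 := h 2
  have h3 := h 3
  have h4 := h 4
  have h5 := h 5
  simp [Fin.sum_univ_six, CartanMatrix.A] at h0 h1 h2 h3 h4 h5
  have e0 : c 0 = 0 := by linarith
  have e1 : c 1 = 0 := by linarith
  have e2 : c 2 = 0 := by linarith
  have e3 : c 3 = 0 := by linarith
  have e4 : c 4 = 0 := by linarith
  have e5 : c 5 = 0 := by linarith
  simp [Fin.sum_univ_six, e0, e1, e2, e3, e4, e5]

/-- The orthogonal projection `r ↦ r'` onto the complement of `A₆`. -/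
def proj : V →ₗ[ℝ] V := a6Perp.projection a6Span isCompl_a6

/-! ### Root lattices and their types -/

/-- A root lattice: a negative definite integral lattice generated by its `(-2)`-vectors. -/
structure IsRootLattice (R : Submodule ℤ V) : Prop where
  integral : ∀ v ∈ R, ∀ w ∈ R, ∃ k : ℤ, form v w = (k : ℝ)
  negDef : ∀ v ∈ R, v ≠ 0 → form v v < 0
  span_roots : Submodule.span ℤ {v | v ∈ R ∧ form v v = -2} = R

/-- The lattice `R` is isometric to the root lattice with Cartan matrix `C`: it has a basis whose
Gram matrix is `-C`. -/
def HasRootType {ι : Type} (R : Submodule ℤ V) (C : Matrix ι ι ℤ) : Prop :=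
  ∃ b : Module.Basis ι ℤ R, ∀ i j, form (b i : V) (b j : V) = -((C i j : ℤ) : ℝ)

/-- The Cartan matrix of type `A₆ ⊕ A₁`. -/
def cartanA6A1 : Matrix (Fin 6 ⊕ Fin 1) (Fin 6 ⊕ Fin 1) ℤ :=
  Matrix.fromBlocks (CartanMatrix.A 6) 0 0 (CartanMatrix.A 1)

/-- The lattice generated by `A₆` and `r`. -/
def withA6 (r : V) : Submodule ℤ V := Submodule.span ℤ (insert r (Set.range a6Root))

/-! ### Conway's fundamental domain and its restriction -/

/-- The Weyl vector `w = (1, 0; 0)`. -/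
def weylVector : V := (1, 0, 0)

/-- The positive cone: the component of `{x | x² > 0}` that has `w` in its closure. -/
def positiveCone : Set V := {x | 0 < form x x ∧ 0 < form x weylVector}

/-- Conway's fundamental domain. -/
def conwayD : Set V := {x | x ∈ positiveCone ∧ ∀ r, IsLeechRoot r → 0 < form x r}

/-- The restriction `D'` of Conway's domain to the complement of `A₆`. The closure is taken because
the open domain does not meet the hyperplanes orthogonal to the six roots of `A₆`. -/
def Dprime : Set V := positiveCone ∩ closure conwayD ∩ a6Perp

/-- The faces (of codimension one) of a convex cone `C`: the exposed faces whose span has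
dimension one less than the span of `C`. -/
def faces (C : Set V) : Set (Set V) :=
  {F | IsExposed ℝ C F ∧
    Module.finrank ℝ (Submodule.span ℝ F) + 1 = Module.finrank ℝ (Submodule.span ℝ C)}

end LeechA6

end

open LeechA6

namespace LeechA6

open Filter Topology

/-! Everything about a Leech root `r` is read off from its pairings `e` with the six roots of the
diagram. Distinct vectors of the Leech lattice differ by a vector of norm at least 4 (`leech_norm`),
so distinct Leech roots have nonnegative integral inner product, and outside the diagram `e` has
entries in the natural numbers. Inverting the Cartan matrix `A` gives `⟨r',r'⟩ = -2 + eᵀA⁻¹e`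
(`form_proj_self`), and `R` is a root lattice of rank 7 exactly when this number is negative. Since
`A⁻¹` has positive entries, this leaves only `e = 0` and the six unit vectors
(`pairing_of_dualNorm_lt`): the new node is either isolated or joined by a simple edge to one node
of the path. The reflection of the path pairs the six positions into the types `A₇`, `D₇`, `E₇`. An
abstract isometry type fixes the Gram determinant, hence `eᵀA⁻¹e` (`dualNorm_eq_of_hasRootType`),
and the four types have different values; this yields the norms of the projections.

For the numbers, prescribing `e` means prescribing the norm of a Leech vector and five linear
functions of it. In each of the seven cases a sum of nonnegative integers turns out to be zero,
which determines the shape of the vector and leaves either octads with given incidences or single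
points to count. The octads are counted in an explicit list of the 4096 Golay words, once the span
of the orbit is known to have the chosen basis.

For the faces, let `w'` be the projection of the Weyl vector. It pairs to at least 1 with every
Leech root outside the diagram, so it is an interior point of `D'`. Different projected roots have
nonnegative inner product, again by positivity of `A⁻¹`. Hence the foot of the perpendicular from
`w'` to the wall of `r` (`facePoint`) lies strictly on the positive side of all other walls, so each
`r` with `⟨r',r'⟩ < 0` gives a face, and distinct `r` give distinct faces. Conversely the walls are
locally finite in the positive cone, so a relative interior point of a face lies on the wall of some
`r`; as that point has positive norm, `r'` has negative norm by the signature
(`exists_wallFace_eq`). -/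

/-! ### Words of the Golay code as bit masks -/

/-- The number of a point of the projective line; the point at infinity has number `23`. -/
def idx (i : Omega) : ℕ := Option.elim i 23 ZMod.val

/-- The binary word with a given bit mask. -/
def toWord (n : ℕ) : Omega → ZMod 2 := fun i => if n.testBit (idx i) then 1 else 0

/-- Bit masks of twelve octads that form a basis of the Golay code. -/
def basisMask : Fin 12 → ℕ :=
  ![13062145, 4845570, 13938692, 7221256, 10170384, 11952160, 15515712, 2019456, 4038912,
    8077824, 11654144, 14919680]

/-- The bit masks of all linear combinations of words with given bit masks. -/
def spanMasks : List ℕ → List ℕ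
  | [] => [0]
  | b :: bs => (spanMasks bs).flatMap fun n => [n, b ^^^ n]

/-- The bit masks of all words of the Golay code. -/
def golayMasks : List ℕ := spanMasks (List.ofFn basisMask)

lemma toWord_xor (a b : ℕ) : toWord (a ^^^ b) = toWord a + toWord b := by
  funext i
  simp only [toWord, Nat.testBit_xor, Pi.add_apply]
  cases a.testBit (idx i) <;> cases b.testBit (idx i) <;> decide

lemma toWord_zero : toWord 0 = 0 := by
  funext i
  simp [toWord]

lemma mem_span_toWord_iff (bs : List ℕ) (c : Omega → ZMod 2) :
    c ∈ Submodule.span (ZMod 2) {c | ∃ b ∈ bs, c = toWord b} ↔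
      ∃ n ∈ spanMasks bs, c = toWord n := by
  induction bs generalizing c with
  | nil => simp [spanMasks, toWord_zero]
  | cons b bs ih =>
    have h : {c | ∃ b' ∈ b :: bs, c = toWord b'} = insert (toWord b) {c | ∃ b ∈ bs, c = toWord b} := by
      ext c
      simp
    rw [h, Submodule.mem_span_insert]
    simp only [spanMasks, List.mem_flatMap, List.mem_cons, List.not_mem_nil, or_false]
    constructor
    · rintro ⟨a, z, hz, rfl⟩
      obtain ⟨n, hn, rfl⟩ := (ih z).1 hz
      rcases (by decide : ∀ a : ZMod 2, a = 0 ∨ a = 1) a with rfl | rfl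
      · exact ⟨n, ⟨n, hn, Or.inl rfl⟩, by simp⟩
      · exact ⟨b ^^^ n, ⟨n, hn, Or.inr rfl⟩, by simp [toWord_xor]⟩
    · rintro ⟨m, ⟨n, hn, rfl | rfl⟩, rfl⟩
      · exact ⟨0, toWord m, (ih _).2 ⟨m, hn, rfl⟩, by simp⟩
      · exact ⟨1, toWord n, (ih _).2 ⟨n, hn, rfl⟩, by simp [toWord_xor]⟩

/-- The code spanned by the twelve basis words. -/
def basisCode : Submodule (ZMod 2) (Omega → ZMod 2) :=
  Submodule.span (ZMod 2) {c | ∃ b ∈ List.ofFn basisMask, c = toWord b}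

lemma toWord_mem_basisCode (k : Fin 12) : toWord (basisMask k) ∈ basisCode :=
  Submodule.subset_span ⟨_, by rw [List.mem_ofFn]; exact ⟨k, rfl⟩, rfl⟩

/-! ### Invariance under the action of `SL(2, 23)` -/

/-- The basis is systematic: among the points `0, …, 11`, basis word `l` is nonzero only at `l`. The
coefficient of word `l` in a code word is therefore its value at `pt l`, and `h` is a finite check
that `σ` carries basis words into the code. -/
lemma comp_mem_basisCode {σ : Omega → Omega}
    (h : ∀ (k : Fin 12) (i : Omega), toWord (basisMask k) (σ i) =
      ∑ l : Fin 12, toWord (basisMask k) (σ (pt (l : ℕ))) * toWord (basisMask l) i)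
    {c : Omega → ZMod 2} (hc : c ∈ basisCode) : c ∘ σ ∈ basisCode := by
  induction hc using Submodule.span_induction with
  | mem c hc =>
    obtain ⟨b, hb, rfl⟩ := hc
    obtain ⟨k, rfl⟩ := List.mem_ofFn.1 hb
    have : toWord (basisMask k) ∘ σ =
        ∑ l : Fin 12, toWord (basisMask k) (σ (pt (l : ℕ))) • toWord (basisMask l) := by
      funext i
      simp [h k i]
    rw [this]
    exact Submodule.sum_mem _ fun l _ => Submodule.smul_mem _ _ (toWord_mem_basisCode l)
  | zero => exact basisCode.zero_mem
  | add c d _ _ hc hd => exact basisCode.add_mem hc hd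
  | smul a c _ hc => exact basisCode.smul_mem a hc

lemma moebius_mul (g h : SL(2, ZMod 23)) : moebius (g * h) = moebius g ∘ moebius h := by
  funext i
  simp [moebius, mul_smul]

lemma moebius_one : moebius 1 = id := by
  funext i
  simp [moebius]

/-- The elements of `SL(2, 23)` that preserve the code spanned by the basis words. -/
def codeStabilizer : Submonoid SL(2, ZMod 23) where
  carrier := {g | ∀ c ∈ basisCode, c ∘ moebius g ∈ basisCode}
  one_mem' := fun c hc => by rw [moebius_one]; exact hc
  mul_mem' := fun {g h} hg hh c hc => by
    rw [moebius_mul, ← Function.comp_assoc]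
    exact hh _ (hg _ hc)

/-- The matrix of the translation by `b`. -/
def slTrans (b : ZMod 23) : SL(2, ZMod 23) := ⟨!![1, b; 0, 1], by simp⟩

/-- The matrix of the multiplication by `a²`. -/
def slDiag (a : ZMod 23) (ha : a ≠ 0) : SL(2, ZMod 23) :=
  ⟨!![a, 0; 0, a⁻¹], by simp [Matrix.det_fin_two_of, ha]⟩

/-- The matrix of the inversion `x ↦ -1 / x`. -/
def slInv : SL(2, ZMod 23) := ⟨!![0, -1; 1, 0], by simp⟩

lemma coe_slTrans (b : ZMod 23) :
    (slTrans b : Matrix (Fin 2) (Fin 2) (ZMod 23)) = !![1, b; 0, 1] := rfl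

lemma coe_slDiag (a : ZMod 23) (ha : a ≠ 0) :
    (slDiag a ha : Matrix (Fin 2) (Fin 2) (ZMod 23)) = !![a, 0; 0, a⁻¹] := rfl

lemma coe_slInv : (slInv : Matrix (Fin 2) (Fin 2) (ZMod 23)) = !![0, -1; 1, 0] := rfl

lemma slTrans_one_mem : slTrans 1 ∈ codeStabilizer := fun c hc => by
  have h : moebius (slTrans 1) = fun i : Omega => i.elim inf fun k => pt (k + 1) := by
    funext i
    induction i using OnePoint.rec with
    | infty => simp [moebius_inf, coe_slTrans]
    | coe k => simp [moebius_pt, coe_slTrans]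
  rw [h]
  exact comp_mem_basisCode (by decide +kernel) hc

lemma slInv_mem : slInv ∈ codeStabilizer := fun c hc => by
  have h : moebius slInv = fun i : Omega =>
      i.elim (pt 0) fun k => if k = 0 then inf else pt (-(k ^ 21)) := by
    funext i
    induction i using OnePoint.rec with
    | infty => simp [moebius_inf, coe_slInv]
    | coe k => simp [moebius_pt, coe_slInv, div_eq_mul_pow]
  rw [h]
  exact comp_mem_basisCode (by decide +kernel) hc

/-- 5 is a primitive root modulo 23, so its powers give all diagonal matrices; it acts as
multiplication by `5² = 2`. -/
lemma slDiag_five_mem : slDiag 5 (by decide) ∈ codeStabilizer := fun c hc => by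
  have h : moebius (slDiag 5 (by decide)) = fun i : Omega => i.elim inf fun k => pt (2 * k) := by
    have h5 : (5 : ZMod 23)⁻¹ = 14 := inv_eq_of_mul_eq_one_right (by decide)
    funext i
    induction i using OnePoint.rec with
    | infty => simp [moebius_inf, coe_slDiag]
    | coe k =>
      have h14 : (14 : ZMod 23) ≠ 0 := by decide
      have : 5 * k / 14 = 2 * k := by
        rw [div_eq_iff h14, show (5 : ZMod 23) = 2 * 14 by decide]
        ring
      simp [moebius_pt, coe_slDiag, h5, h14, this]
  rw [h]
  exact comp_mem_basisCode (by decide +kernel) hc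

lemma slTrans_mem (b : ZMod 23) : slTrans b ∈ codeStabilizer := by
  have h : ∀ n : ℕ, slTrans n = slTrans 1 ^ n := fun n => by
    induction n with
    | zero =>
      ext i j
      fin_cases i <;> fin_cases j <;> simp [coe_slTrans]
    | succ n ih =>
      rw [pow_succ, ← ih]
      ext i j
      fin_cases i <;> fin_cases j <;>
        simp [coe_slTrans, Matrix.SpecialLinearGroup.coe_mul, add_comm]
  obtain ⟨n, rfl⟩ := ZMod.natCast_zmod_surjective b
  rw [h]
  exact codeStabilizer.pow_mem slTrans_one_mem n

lemma slDiag_mem (a : ZMod 23) (ha : a ≠ 0) : slDiag a ha ∈ codeStabilizer := by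
  have h5 : (5 : ZMod 23) ≠ 0 := by decide
  have h : ∀ (n : ℕ) (hn : (5 : ZMod 23) ^ n ≠ 0), slDiag (5 ^ n) hn = slDiag 5 h5 ^ n := by
    intro n
    induction n with
    | zero =>
      intro hn
      ext i j
      fin_cases i <;> fin_cases j <;> simp [coe_slDiag]
    | succ n ih =>
      intro hn
      rw [pow_succ (slDiag 5 h5), ← ih (pow_ne_zero n h5)]
      ext i j
      fin_cases i <;> fin_cases j <;>
        simp [coe_slDiag, Matrix.SpecialLinearGroup.coe_mul, pow_succ, mul_comm]
  have hs : ∀ a : ZMod 23, a ≠ 0 → ∃ n : Fin 22, a = 5 ^ (n : ℕ) := by decide +kernel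
  obtain ⟨n, rfl⟩ := hs a ha
  rw [h]
  exact codeStabilizer.pow_mem slDiag_five_mem n

/-- Bruhat decomposition: every matrix is upper triangular or a product of an upper triangular one,
the inversion and another upper triangular one, according to whether the lower left entry vanishes.
-/
lemma mem_codeStabilizer (g : SL(2, ZMod 23)) : g ∈ codeStabilizer := by
  have hdet : g 0 0 * g 1 1 - g 0 1 * g 1 0 = 1 := by
    rw [← Matrix.det_fin_two]
    exact g.2
  by_cases hc : g 1 0 = 0
  · have hd : g 0 0 * g 1 1 = 1 := by simpa [hc] using hdet
    have ha : g 0 0 ≠ 0 := left_ne_zero_of_mul_eq_one hd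
    have hg : g = slDiag (g 0 0) ha * slTrans (g 0 1 / g 0 0) := by
      ext i j
      fin_cases i <;> fin_cases j <;>
        simp [coe_slDiag, coe_slTrans, Matrix.SpecialLinearGroup.coe_mul, hc]
      · field_simp
      · exact eq_inv_of_mul_eq_one_right hd
    rw [hg]
    exact codeStabilizer.mul_mem (slDiag_mem _ _) (slTrans_mem _)
  · have hg : g = slTrans (g 0 0 / g 1 0) * (slInv * (slDiag (g 1 0) hc *
        slTrans (g 1 1 / g 1 0))) := by
      ext i j
      fin_cases i <;> fin_cases j <;>
        simp [coe_slDiag, coe_slTrans, coe_slInv, Matrix.SpecialLinearGroup.coe_mul]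
      · field_simp
      · field_simp
        linear_combination -hdet
      · field_simp
    rw [hg]
    exact codeStabilizer.mul_mem (slTrans_mem _) (codeStabilizer.mul_mem slInv_mem
      (codeStabilizer.mul_mem (slDiag_mem _ _) (slTrans_mem _)))

lemma image_moebius_indicator (K : Finset Omega) (g : SL(2, ZMod 23)) :
    (fun i => if i ∈ K.image (moebius g) then 1 else 0 : Omega → ZMod 2) =
      (fun i => if i ∈ K then 1 else 0) ∘ moebius g⁻¹ := by
  have h1 : ∀ i, moebius g (moebius g⁻¹ i) = i := fun i => by
    rw [← Function.comp_apply (f := moebius g), ← moebius_mul, mul_inv_cancel, moebius_one, id]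
  have h2 : ∀ i, moebius g⁻¹ (moebius g i) = i := fun i => by
    rw [← Function.comp_apply (f := moebius g⁻¹), ← moebius_mul, inv_mul_cancel, moebius_one, id]
  funext i
  have : i ∈ K.image (moebius g) ↔ moebius g⁻¹ i ∈ K := by
    rw [Finset.mem_image]
    exact ⟨by rintro ⟨k, hk, rfl⟩; rwa [h2], fun h => ⟨_, h, h1 i⟩⟩
  simp only [this, Function.comp_apply]

/-- Matrices in `SL(2, 23)` that map the base octad to the octads of the basis. -/
def basisMatrix : Fin 12 → ZMod 23 × ZMod 23 × ZMod 23 × ZMod 23 :=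
  ![(0, 10, 16, 13), (1, 3, 16, 3), (3, 11, 22, 12), (3, 9, 2, 14), (1, 18, 6, 17), (1, 6, 5, 8),
    (3, 4, 4, 21), (2, 9, 20, 10), (1, 4, 3, 13), (1, 4, 5, 21), (5, 6, 8, 19), (2, 10, 19, 15)]

lemma toWord_basisMask_mem (k : Fin 12) : toWord (basisMask k) ∈ golay := by
  have hd : ∀ k : Fin 12, (basisMatrix k).1 * (basisMatrix k).2.2.2 -
      (basisMatrix k).2.1 * (basisMatrix k).2.2.1 = 1 := by decide +kernel
  have h := golay_octad (mem_octads_of_matrix _ _ _ _ (hd k))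
  convert h using 1
  clear h
  revert k
  decide +kernel

/-- The base octad lies in the code of the basis, and invariance under the group brings its whole
orbit along. Conversely `basisMatrix` exhibits every basis word as an octad of the orbit. -/
lemma golay_eq_basisCode : golay = basisCode := by
  refine le_antisymm (Submodule.span_le.2 ?_) (Submodule.span_le.2 ?_)
  · rintro _ ⟨_, ⟨g, rfl⟩, rfl⟩
    rw [image_moebius_indicator]
    refine mem_codeStabilizer _ _ ?_
    have : (fun i => if i ∈ baseOctad then 1 else 0 : Omega → ZMod 2) =
        ∑ l : Fin 12, (if pt (l : ℕ) ∈ baseOctad then 1 else 0 : ZMod 2) • toWord (basisMask l) := by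
      decide +kernel
    rw [this]
    exact Submodule.sum_mem _ fun l _ => Submodule.smul_mem _ _ (toWord_mem_basisCode l)
  · rintro _ ⟨b, hb, rfl⟩
    obtain ⟨k, rfl⟩ := List.mem_ofFn.1 hb
    exact toWord_basisMask_mem k

lemma mem_golay_iff (c : Omega → ZMod 2) : c ∈ golay ↔ ∃ n ∈ golayMasks, c = toWord n := by
  rw [golay_eq_basisCode]
  exact mem_span_toWord_iff _ c

/-! ### Weights and counts of Golay code words -/

/-- The integral indicator of the support of a binary word. -/
def ind (c : Omega → ZMod 2) (i : Omega) : ℤ := if c i = 0 then 0 else 1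

/-- The number of ones among the lowest four bits, read off from a table. -/
def nibbleWeight (n : ℕ) : ℕ := (0x4332322132212110 >>> (4 * (n % 16))) % 16

/-- The number of ones among the lowest 24 bits. -/
def weight (n : ℕ) : ℕ :=
  nibbleWeight n + nibbleWeight (n >>> 4) + nibbleWeight (n >>> 8) + nibbleWeight (n >>> 12) +
    nibbleWeight (n >>> 16) + nibbleWeight (n >>> 20)

/-- The bit mask of the octad `K0`. -/
def K0Mask : ℕ := 5275709

lemma sum_idx (f : ℕ → ℤ) : ∑ i : Omega, f (idx i) = ∑ k ∈ Finset.range 24, f k := by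
  refine Finset.sum_nbij idx ?_ ?_ ?_ fun _ _ => rfl
  · decide
  · rw [Finset.coe_univ]
    intro i _ j _
    revert i j
    decide
  · intro k hk
    have : ∀ k : Fin 24, ∃ i : Omega, idx i = k := by decide
    obtain ⟨i, hi⟩ := this ⟨k, by simpa using hk⟩
    exact ⟨i, by simp, hi⟩

lemma cast_nibbleWeight (n : ℕ) :
    (nibbleWeight n : ℤ) = ∑ k ∈ Finset.range 4, if n.testBit k then 1 else 0 := by
  have h : ∀ x : Fin 16, ((0x4332322132212110 >>> (4 * (x : ℕ))) % 16 : ℕ) =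
      ∑ k ∈ Finset.range 4, if (x : ℕ).testBit k then 1 else 0 := by decide
  have h' := h ⟨n % 16, Nat.mod_lt _ (by norm_num)⟩
  rw [nibbleWeight, h']
  push_cast
  refine Finset.sum_congr rfl fun k hk => ?_
  rw [show n % 16 = n % 2 ^ 4 from rfl, Nat.testBit_mod_two_pow]
  simp [Finset.mem_range.1 hk]

lemma cast_weight (n : ℕ) :
    (weight n : ℤ) = ∑ k ∈ Finset.range 24, if n.testBit k then 1 else 0 := by
  simp only [weight, Nat.cast_add, cast_nibbleWeight, Nat.testBit_shiftRight,
    Finset.sum_range_succ, Finset.sum_range_zero]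
  ring

lemma ind_toWord (n : ℕ) (i : Omega) : ind (toWord n) i = if n.testBit (idx i) then 1 else 0 := by
  unfold ind toWord
  cases n.testBit (idx i) <;> simp

lemma sum_ind_toWord (n : ℕ) : ∑ i, ind (toWord n) i = weight n := by
  rw [cast_weight, ← sum_idx]
  exact Finset.sum_congr rfl fun i _ => ind_toWord n i

lemma sum_ind_toWord_K0 (n : ℕ) : ∑ i, ind (toWord n) i * nu K0 i = weight (n &&& K0Mask) := by
  have h : ∀ i, nu K0 i = if K0Mask.testBit (idx i) then 1 else 0 := by decide +kernel
  rw [cast_weight, ← sum_idx]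
  refine Finset.sum_congr rfl fun i _ => ?_
  rw [ind_toWord, h, Nat.testBit_and]
  cases n.testBit (idx i) <;> cases K0Mask.testBit (idx i) <;> rfl

lemma toWord_injOn : Set.InjOn toWord {n | n < 2 ^ 24} := by
  intro m hm n hn h
  refine Nat.eq_of_testBit_eq fun k => ?_
  by_cases hk : k < 24
  · have : ∀ k : Fin 24, ∃ i : Omega, idx i = k := by decide
    obtain ⟨i, hi⟩ := this ⟨k, hk⟩
    have := congrFun h i
    simp only [toWord, hi] at this
    revert this
    cases m.testBit k <;> cases n.testBit k <;> simp
  · have hk' : 2 ^ 24 ≤ 2 ^ k := Nat.pow_le_pow_right (by norm_num) (by omega)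
    rw [Nat.testBit_lt_two_pow (lt_of_lt_of_le hm hk'), Nat.testBit_lt_two_pow (lt_of_lt_of_le hn hk')]

/-- An exhaustive check of all 4096 words. The weights drive the norm estimates; the bound on the
masks makes `toWord` injective on them. -/
lemma golayMasks_spec : (golayMasks.all fun n => decide (n < 2 ^ 24) &&
    [0, 8, 12, 16, 24].contains (weight n)) = true := by decide +kernel

lemma golay_weight {c : Omega → ZMod 2} (hc : c ∈ golay) :
    ∑ i, ind c i = 0 ∨ ∑ i, ind c i = 8 ∨ ∑ i, ind c i = 12 ∨ ∑ i, ind c i = 16 ∨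
      ∑ i, ind c i = 24 := by
  obtain ⟨n, hn, rfl⟩ := (mem_golay_iff c).1 hc
  have h := List.all_eq_true.1 golayMasks_spec n hn
  simp only [Bool.and_eq_true, List.contains_eq_mem, decide_eq_true_eq, List.mem_cons,
    List.not_mem_nil, or_false] at h
  rw [sum_ind_toWord]
  exact_mod_cast h.2

/-- The words of the octads with prescribed values at `∞`, `0`, `1` and prescribed intersection
number with `K0`. -/
def octadWords (u v w k : ℕ) : Set (Omega → ZMod 2) :=
  {c | c ∈ golay ∧ ∑ i, ind c i = 8 ∧ ind c inf = u ∧ ind c (pt 0) = v ∧ ind c (pt 1) = w ∧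
    ∑ i, ind c i * nu K0 i = k}

/-- The bit masks of the words in `octadWords`. -/
def octadMasks (u v w k : ℕ) : List ℕ :=
  golayMasks.filter fun n => (n.testBit 23).toNat == u && ((n.testBit 0).toNat == v &&
    ((n.testBit 1).toNat == w && (weight n == 8 && weight (n &&& K0Mask) == k)))

lemma octadWords_ncard (u v w k : ℕ) :
    (octadWords u v w k).ncard = (octadMasks u v w k).toFinset.card := by
  have hi : ∀ (b : Bool) (u : ℕ), ((if b then 1 else 0 : ℤ) = u) ↔ b.toNat = u := by
    intro b u
    cases b <;> simp <;> norm_cast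
  have h : octadWords u v w k = toWord '' ((octadMasks u v w k).toFinset : Set ℕ) := by
    ext c
    simp only [octadWords, Set.mem_ofPred_eq, mem_golay_iff, Set.mem_image, List.coe_toFinset,
      octadMasks, List.mem_filter, Bool.and_eq_true, beq_iff_eq]
    constructor
    · rintro ⟨⟨n, hn, rfl⟩, h1, h2, h3, h4, h5⟩
      rw [sum_ind_toWord] at h1
      rw [sum_ind_toWord_K0] at h5
      rw [ind_toWord, hi] at h2 h3 h4
      exact ⟨n, ⟨hn, h2, h3, h4, by exact_mod_cast h1, by exact_mod_cast h5⟩, rfl⟩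
    · rintro ⟨n, ⟨hn, h2, h3, h4, h1, h5⟩, rfl⟩
      rw [sum_ind_toWord, sum_ind_toWord_K0, ind_toWord, ind_toWord, ind_toWord, hi, hi, hi]
      exact ⟨⟨n, hn, rfl⟩, by exact_mod_cast h1, h2, h3, h4, by exact_mod_cast h5⟩
  rw [h, Set.InjOn.ncard_image (toWord_injOn.mono fun n hn => ?_), Set.ncard_coe_finset]
  have hn' : n ∈ golayMasks := (List.mem_filter.1 (List.mem_toFinset.1 hn)).1
  have h := List.all_eq_true.1 golayMasks_spec n hn'
  simp only [Bool.and_eq_true, decide_eq_true_eq] at h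
  exact h.1

/-- These counts serve six of the seven levels; the remaining one, `ncard_leechLevel_four`, counts
points instead of octads. -/
lemma card_octadMasks : [octadMasks 1 1 0 4, octadMasks 1 0 1 0, octadMasks 1 1 1 2,
    octadMasks 0 1 1 2, octadMasks 1 1 0 2, octadMasks 1 1 1 4].map (fun l => l.toFinset.card) =
      [28, 7, 14, 28, 28, 7] := by
  decide +kernel

lemma ncard_octadWords : (octadWords 1 1 0 4).ncard = 28 ∧ (octadWords 1 0 1 0).ncard = 7 ∧
    (octadWords 1 1 1 2).ncard = 14 ∧ (octadWords 0 1 1 2).ncard = 28 ∧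
    (octadWords 1 1 0 2).ncard = 28 ∧ (octadWords 1 1 1 4).ncard = 7 := by
  simp only [octadWords_ncard]
  have h := card_octadMasks
  simp only [List.map_cons, List.map_nil, List.cons.injEq, and_true] at h
  exact h

/-! ### Vectors of the Leech lattice -/

lemma ind_sq (c : Omega → ZMod 2) (i : Omega) : ind c i ^ 2 = ind c i := by
  unfold ind
  split_ifs <;> norm_num

lemma ind_eq_zero_or_one (c : Omega → ZMod 2) (i : Omega) : ind c i = 0 ∨ ind c i = 1 := by
  unfold ind
  split_ifs <;> simp

lemma ind_injective : Function.Injective ind := by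
  intro c d h
  funext i
  have h1 := congrFun h i
  have h2 : ∀ x y : ZMod 2, ((if x = 0 then 0 else 1 : ℤ) = if y = 0 then 0 else 1) → x = y := by
    decide
  exact h2 _ _ h1

lemma sum_one_omega : ∑ _i : Omega, (1 : ℤ) = 24 := by decide

lemma sum_mul_nu_singleton (f : Omega → ℤ) (p : Omega) : ∑ i, f i * nu {p} i = f p := by
  simp [nu]

/-- The word `c` marks the coordinates congruent to 2 modulo 4 in the even case and to 3 in the odd
case; by `forall_isCSet_iff` this one residue class decides all the others. -/
lemma mem_leech_iff (ξ : Omega → ℤ) :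
    ξ ∈ leech ↔ ∃ c ∈ golay, ∃ t : Omega → ℤ,
      ((∀ i, ξ i = 2 * ind c i + 4 * t i) ∧ (∑ i, ξ i) % 8 = 0) ∨
      ((∀ i, ξ i = 1 - 2 * ind c i + 4 * t i) ∧ (∑ i, ξ i) % 8 = 4) := by
  constructor
  · rintro ⟨m, hm, hc, hs⟩
    rcases Int.emod_two_eq_zero_or_one m with h | h
    · obtain ⟨c, hc, hS⟩ := hc 2
      refine ⟨c, hc, fun i => ξ i / 4, Or.inl ⟨fun i => ?_, ?_⟩⟩
      · have h1 : ξ i % 4 = 2 % 4 ↔ c i ≠ 0 := Set.ext_iff.1 hS i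
        have h2 : ξ i % 2 = m % 2 := hm i
        beta_reduce
        unfold ind
        split_ifs with h3
        · have := mt h1.1 (not_not.2 h3)
          omega
        · have := h1.2 h3
          omega
      · have : (∑ i, ξ i) % 8 = 4 * m % 8 := hs
        omega
    · obtain ⟨c, hc, hS⟩ := hc 3
      refine ⟨c, hc, fun i => (ξ i + 1) / 4, Or.inr ⟨fun i => ?_, ?_⟩⟩
      · have h1 : ξ i % 4 = 3 % 4 ↔ c i ≠ 0 := Set.ext_iff.1 hS i
        have h2 : ξ i % 2 = m % 2 := hm i
        beta_reduce
        unfold ind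
        split_ifs with h3
        · have := mt h1.1 (not_not.2 h3)
          omega
        · have := h1.2 h3
          omega
      · have : (∑ i, ξ i) % 8 = 4 * m % 8 := hs
        omega
  · rintro ⟨c, hc, t, ⟨ht, hs⟩ | ⟨ht, hs⟩⟩
    · have hm : ∀ i, ξ i ≡ 0 [ZMOD 2] := fun i => by
        have := ht i
        simp only [Int.ModEq]
        omega
      refine ⟨0, hm, (forall_isCSet_iff hm).2 ⟨c, hc, ?_⟩, by simp only [Int.ModEq]; omega⟩
      ext i
      have := ht i
      simp only [Set.mem_ofPred_eq, Function.mem_support, Int.ModEq]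
      unfold ind at this
      split_ifs at this with h
      · simp only [ne_eq, h, not_true_eq_false, iff_false]
        omega
      · simp only [ne_eq, h, not_false_eq_true, iff_true]
        omega
    · have hm : ∀ i, ξ i ≡ 1 [ZMOD 2] := fun i => by
        have := ht i
        simp only [Int.ModEq]
        omega
      refine ⟨1, hm, (forall_isCSet_iff hm).2 ⟨c, hc, ?_⟩, by simp only [Int.ModEq]; omega⟩
      ext i
      have := ht i
      simp only [Set.mem_ofPred_eq, Function.mem_support, Int.ModEq]
      unfold ind at this
      split_ifs at this with h
      · simp only [ne_eq, h, not_true_eq_false, iff_false]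
        omega
      · simp only [ne_eq, h, not_false_eq_true, iff_true]
        omega

/-- Let `W` be the weight of `c`. In the even case the norm is at least `4W`, so a value below 32
forces `W = 0`; then the norm is `16 ∑ tᵢ²`, where `∑ tᵢ²` has the parity of `∑ tᵢ`, which is even
by the condition modulo 8. In the odd case all 24 coordinates are odd, so the norm is at least 24,
and the condition modulo 8 makes it divisible by 16. -/
lemma leech_norm {ξ : Omega → ℤ} (hξ : ξ ∈ leech) (h0 : ξ ≠ 0) :
    32 ≤ ∑ i, ξ i ^ 2 ∧ (16 : ℤ) ∣ ∑ i, ξ i ^ 2 := by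
  have hpos : 0 < ∑ i, ξ i ^ 2 := by
    obtain ⟨i, hi⟩ := Function.ne_iff.1 h0
    exact Finset.sum_pos' (fun i _ => sq_nonneg _) ⟨i, Finset.mem_univ i, by
      have : ξ i ≠ 0 := hi
      positivity⟩
  obtain ⟨c, hc, t, ⟨ht, hs⟩ | ⟨ht, hs⟩⟩ := (mem_leech_iff ξ).1 hξ
  · have hW := golay_weight hc
    have hN : ∑ i, ξ i ^ 2 = 4 * ∑ i, ind c i + 16 * ∑ i, (ind c i * t i + t i ^ 2) := by
      rw [Finset.mul_sum, Finset.mul_sum, ← Finset.sum_add_distrib]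
      refine Finset.sum_congr rfl fun i _ => ?_
      rw [ht]
      linear_combination 4 * ind_sq c i
    have hS : ∑ i, ξ i = 2 * ∑ i, ind c i + 4 * ∑ i, t i := by
      rw [Finset.mul_sum, Finset.mul_sum, ← Finset.sum_add_distrib]
      exact Finset.sum_congr rfl fun i _ => ht i
    refine ⟨?_, by omega⟩
    by_contra hlt
    have h16 : ∑ i, ξ i ^ 2 = 16 := by omega
    have hle : 4 * ∑ i, ind c i ≤ ∑ i, ξ i ^ 2 := by
      rw [Finset.mul_sum]
      refine Finset.sum_le_sum fun i _ => ?_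
      rw [ht]
      rcases ind_eq_zero_or_one c i with h | h
      · rw [h]
        nlinarith [sq_nonneg (t i)]
      · rw [h]
        have : 0 ≤ t i * (t i + 1) := by
          rcases lt_or_ge (t i) 0 with h | h
          · exact mul_nonneg_of_nonpos_of_nonpos h.le (by omega)
          · positivity
        nlinarith
    have hW0 : ∑ i, ind c i = 0 := by omega
    have hz : ∀ i, ind c i = 0 := by
      have := (Finset.sum_eq_zero_iff_of_nonneg fun i _ => by
        rcases ind_eq_zero_or_one c i with h | h <;> simp [h]).1 hW0
      exact fun i => this i (Finset.mem_univ i)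
    have hT : ∑ i, (ind c i * t i + t i ^ 2) = ∑ i, t i * (t i - 1) + ∑ i, t i := by
      rw [← Finset.sum_add_distrib]
      refine Finset.sum_congr rfl fun i _ => ?_
      rw [hz]
      ring
    have heven : (2 : ℤ) ∣ ∑ i, t i * (t i - 1) :=
      Finset.dvd_sum fun i _ => (Int.even_mul_pred_self (t i)).two_dvd
    omega
  · have hW := golay_weight hc
    have hN : ∑ i, ξ i ^ 2 = 24 + 8 * ∑ i, t i + 16 * ∑ i, (t i ^ 2 - ind c i * t i) := by
      have h24 : (24 : ℤ) = ∑ _i : Omega, 1 := sum_one_omega.symm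
      rw [h24, Finset.mul_sum, Finset.mul_sum, ← Finset.sum_add_distrib, ← Finset.sum_add_distrib]
      refine Finset.sum_congr rfl fun i _ => ?_
      rw [ht]
      linear_combination 4 * ind_sq c i
    have hS : ∑ i, ξ i = 24 - 2 * ∑ i, ind c i + 4 * ∑ i, t i := by
      have h24 : (24 : ℤ) = ∑ _i : Omega, 1 := sum_one_omega.symm
      rw [h24, Finset.mul_sum, Finset.mul_sum, ← Finset.sum_sub_distrib, ← Finset.sum_add_distrib]
      exact Finset.sum_congr rfl fun i _ => ht i
    have hge : (24 : ℤ) ≤ ∑ i, ξ i ^ 2 := by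
      have h24 : (24 : ℤ) = ∑ _i : Omega, 1 := sum_one_omega.symm
      rw [h24]
      refine Finset.sum_le_sum fun i _ => ?_
      have : ξ i ≠ 0 := by
        have := ht i
        omega
      have := Int.one_le_abs this
      rw [← sq_abs]
      nlinarith
    omega

/-- By `form_leechRoot` the number `n` is the inner product of the two Leech roots. -/
lemma leech_dist {ξ η : Omega → ℤ} (hξ : ξ ∈ leech) (hη : η ∈ leech) (h : ξ ≠ η) :
    ∃ n : ℕ, ∑ i, (ξ i - η i) ^ 2 = 32 + 16 * (n : ℤ) := by
  obtain ⟨h1, k, hk⟩ := leech_norm (leech.sub_mem hξ hη) (sub_ne_zero.2 h)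
  simp only [Pi.sub_apply] at h1 hk
  exact ⟨(k - 2).toNat, by omega⟩

/-! ### Distances from the six vectors of `A₆` -/

/-- The sum of squares of the difference between `ξ` and a vector of the `A₆`. -/
def distA6 (ξ : Omega → ℤ) (j : Fin 6) : ℤ := ∑ i, (ξ i - a6Vector j i) ^ 2

/-- The Leech vectors with prescribed inner products of their Leech roots with the `A₆`. -/
def leechLevel (e : Fin 6 → ℤ) : Set (Omega → ℤ) :=
  {ξ | ξ ∈ leech ∧ ∀ j, distA6 ξ j = 32 + 16 * e j}

lemma distA6_eq (ξ : Omega → ℤ) (j : Fin 6) : distA6 ξ j =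
    ∑ i, ξ i ^ 2 - 2 * ∑ i, ξ i * a6Vector j i + ∑ i, a6Vector j i ^ 2 := by
  rw [distA6, Finset.mul_sum, ← Finset.sum_sub_distrib, ← Finset.sum_add_distrib]
  exact Finset.sum_congr rfl fun i _ => by ring

/-- The root `z` belongs to the zero vector, so `e 1` fixes the norm of `ξ`; subtracting it from the
other five distances leaves linear equations. -/
lemma forall_distA6_iff (ξ : Omega → ℤ) (e : Fin 6 → ℤ) :
    (∀ j, distA6 ξ j = 32 + 16 * e j) ↔
      ∑ i, ξ i ^ 2 = 32 + 16 * e 1 ∧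
      2 * (4 * ξ (pt 0) + ∑ i, ξ i) = 48 + 16 * e 1 - 16 * e 0 ∧
      2 * (4 * ξ inf + ∑ i, ξ i) = 48 + 16 * e 1 - 16 * e 2 ∧
      4 * ∑ i, ξ i * nu K0 i = 32 + 16 * e 1 - 16 * e 3 ∧
      8 * (ξ inf + ξ (pt 0)) = 32 + 16 * e 1 - 16 * e 4 ∧
      2 * (∑ i, ξ i - 4 * ξ (pt 1)) = 32 + 16 * e 1 - 16 * e 5 := by
  have hn : ∀ j, ∑ i, a6Vector j i ^ 2 = ![48, 0, 48, 32, 32, 32] j := by decide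
  have hu : ∀ i, nu Finset.univ i = 1 := fun i => by simp [nu]
  have h0 : ∑ i, ξ i * a6Vector 0 i = 4 * ξ (pt 0) + ∑ i, ξ i := by
    rw [← sum_mul_nu_singleton ξ (pt 0), Finset.mul_sum, ← Finset.sum_add_distrib]
    exact Finset.sum_congr rfl fun i _ => by simp [a6Vector, hu]; ring
  have h1 : ∑ i, ξ i * a6Vector 1 i = 0 := by simp [a6Vector]
  have h2 : ∑ i, ξ i * a6Vector 2 i = 4 * ξ inf + ∑ i, ξ i := by
    rw [← sum_mul_nu_singleton ξ inf, Finset.mul_sum, ← Finset.sum_add_distrib]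
    exact Finset.sum_congr rfl fun i _ => by simp [a6Vector, hu]; ring
  have h3 : ∑ i, ξ i * a6Vector 3 i = 2 * ∑ i, ξ i * nu K0 i := by
    rw [Finset.mul_sum]
    exact Finset.sum_congr rfl fun i _ => by simp [a6Vector]; ring
  have h4 : ∑ i, ξ i * a6Vector 4 i = 4 * (ξ inf + ξ (pt 0)) := by
    rw [← sum_mul_nu_singleton ξ inf, ← sum_mul_nu_singleton ξ (pt 0), ← Finset.sum_add_distrib,
      Finset.mul_sum]
    exact Finset.sum_congr rfl fun i _ => by simp [a6Vector]; ring
  have h5 : ∑ i, ξ i * a6Vector 5 i = ∑ i, ξ i - 4 * ξ (pt 1) := by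
    rw [← sum_mul_nu_singleton ξ (pt 1), Finset.mul_sum, ← Finset.sum_sub_distrib]
    exact Finset.sum_congr rfl fun i _ => by simp [a6Vector, hu]; ring
  have hn0 := hn 0
  have hn1 := hn 1
  have hn2 := hn 2
  have hn3 := hn 3
  have hn4 := hn 4
  have hn5 := hn 5
  simp at hn0 hn1 hn2 hn3 hn4 hn5
  simp only [Fin.forall_fin_succ, distA6_eq, Fin.isValue, Fin.succ_zero_eq_one, Fin.succ_one_eq_two,
    IsEmpty.forall_iff, and_true]
  simp only [show (Fin.succ 2 : Fin 6) = 3 from rfl, show (Fin.succ 2 : Fin 5) = 3 from rfl,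
    show (Fin.succ 3 : Fin 6) = 4 from rfl, show (Fin.succ 4 : Fin 6) = 5 from rfl,
    show (Fin.succ 2 : Fin 4) = 3 from rfl, show (Fin.succ 3 : Fin 5) = 4 from rfl]
  rw [h0, h1, h2, h3, h4, h5, hn0, hn1, hn2, hn3, hn4, hn5]
  omega

/-! ### Enumeration of the Leech vectors with given distances from the `A₆` -/

lemma ind_mul_self (c : Omega → ZMod 2) (i : Omega) : ind c i * ind c i = ind c i := by
  rw [← sq, ind_sq]

lemma eq_zero_of_sum_eq_zero {f : Omega → ℤ} (hf : ∀ i, 0 ≤ f i) (h : ∑ i, f i = 0) (i : Omega) :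
    f i = 0 :=
  (Finset.sum_eq_zero_iff_of_nonneg fun i _ => hf i).1 h i (Finset.mem_univ i)

lemma one_le_sq_of_odd {x : ℤ} (h : x % 2 = 1) : 1 ≤ x ^ 2 := by
  have : x ≠ 0 := by rintro rfl; simp at h
  have : 0 < x ^ 2 := by positivity
  omega

/-- The sum of `ξᵢ(ξᵢ - 2)` is `32 - 2·16 = 0`, and its terms are nonnegative for even entries. So
all entries are 0 or 2, and `ξ` is twice an octad. -/
lemma ncard_leechLevel_even {e : Fin 6 → ℤ} {u v w k : ℕ}
    (he : ∀ ξ, (∀ j, distA6 ξ j = 32 + 16 * e j) ↔ ∑ i, ξ i ^ 2 = 32 ∧ ∑ i, ξ i = 16 ∧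
      ξ inf = 2 * u ∧ ξ (pt 0) = 2 * v ∧ ξ (pt 1) = 2 * w ∧ ∑ i, ξ i * nu K0 i = 2 * k) :
    (leechLevel e).ncard = (octadWords u v w k).ncard := by
  have h : leechLevel e = (fun c i => 2 * ind c i) '' octadWords u v w k := by
    ext ξ
    simp only [leechLevel, octadWords, Set.mem_ofPred_eq, Set.mem_image, he]
    constructor
    · rintro ⟨hξ, hN, hs, hu, hv, hw, hk⟩
      obtain ⟨c, hc, t, ⟨ht, -⟩ | ⟨ht, -⟩⟩ := (mem_leech_iff ξ).1 hξ
      · have hx : ∀ i, ξ i = 2 * ind c i := by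
          have h0 : ∀ i, ξ i * (ξ i - 2) = 0 := by
            refine eq_zero_of_sum_eq_zero (fun i => ?_) ?_
            · have := ht i
              rcases le_or_gt (ξ i) 0 with h | h
              · exact mul_nonneg_of_nonpos_of_nonpos h (by omega)
              · exact mul_nonneg h.le (by omega)
            · have : ∑ i, ξ i * (ξ i - 2) = ∑ i, ξ i ^ 2 - 2 * ∑ i, ξ i := by
                rw [Finset.mul_sum, ← Finset.sum_sub_distrib]
                exact Finset.sum_congr rfl fun i _ => by ring
              omega
          intro i
          have h1 := ht i
          have h2 := ind_eq_zero_or_one c i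
          rcases mul_eq_zero.1 (h0 i) with h | h <;> omega
        simp only [hx, mul_assoc, ← Finset.mul_sum] at hs hu hv hw hk
        exact ⟨c, ⟨hc, by omega, by omega, by omega, by omega, by omega⟩, funext fun i => (hx i).symm⟩
      · have := ht inf
        omega
    · rintro ⟨c, ⟨hc, h8, hu, hv, hw, hk⟩, rfl⟩
      simp only [mul_pow, ind_sq, mul_assoc, ← Finset.mul_sum, h8, hu, hv, hw, hk]
      refine ⟨(mem_leech_iff _).2 ⟨c, hc, 0, Or.inl ⟨fun i => by simp, ?_⟩⟩, by norm_num⟩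
      rw [← Finset.mul_sum, h8]
      rfl
  rw [h]
  refine Set.ncard_image_of_injective _ fun c d h => ind_injective (funext fun i => ?_)
  have := congrFun h i
  simpa using this

lemma nu_singleton_eq (p i : Omega) : nu {p} i = if i = p then 1 else 0 := by
  simp [nu]

lemma sum_nu_singleton (p : Omega) : ∑ i, nu {p} i = 1 := by simp [nu]

/-- The entry at `p` contributes 9 to the norm 32, so the other 23 odd entries have squares summing
to 23 and are all `±1`. The word `c` then contains `p`, since `3 = 1 - 2 + 4`, and the coordinate
sum 12 makes it an octad. -/
lemma ncard_leechLevel_odd {e : Fin 6 → ℤ} {u v w k : ℕ} (p : Omega)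
    (he : ∀ ξ, (∀ j, distA6 ξ j = 32 + 16 * e j) ↔ ∑ i, ξ i ^ 2 = 32 ∧ ∑ i, ξ i = 12 ∧
      ξ inf = 1 - 2 * u + 4 * nu {p} inf ∧ ξ (pt 0) = 1 - 2 * v + 4 * nu {p} (pt 0) ∧
      ξ (pt 1) = 1 - 2 * w + 4 * nu {p} (pt 1) ∧
      ∑ i, ξ i * nu K0 i = 8 - 2 * k + 4 * nu K0 p)
    (hp : ∀ ξ, (∀ j, distA6 ξ j = 32 + 16 * e j) → ξ p = 3)
    (hpc : ∀ c ∈ octadWords u v w k, ind c p = 1) :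
    (leechLevel e).ncard = (octadWords u v w k).ncard := by
  have hK : ∑ i, nu K0 i = 8 := by decide
  have hsum : ∀ o : Omega → ℤ, ∑ i, (1 - 2 * o i + 4 * nu {p} i) = 28 - 2 * ∑ i, o i := by
    intro o
    rw [Finset.sum_add_distrib, Finset.sum_sub_distrib, sum_one_omega, ← Finset.mul_sum,
      ← Finset.mul_sum, sum_nu_singleton]
    ring
  have hsumK : ∀ o : Omega → ℤ, ∑ i, (1 - 2 * o i + 4 * nu {p} i) * nu K0 i =
      8 - 2 * ∑ i, o i * nu K0 i + 4 * nu K0 p := by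
    intro o
    rw [← hK, ← sum_mul_nu_singleton (nu K0) p, Finset.mul_sum, Finset.mul_sum,
      ← Finset.sum_sub_distrib, ← Finset.sum_add_distrib]
    exact Finset.sum_congr rfl fun i _ => by ring
  have h : leechLevel e = (fun c i => 1 - 2 * ind c i + 4 * nu {p} i) '' octadWords u v w k := by
    ext ξ
    simp only [leechLevel, Set.mem_ofPred_eq, Set.mem_image]
    constructor
    · rintro ⟨hξ, hd⟩
      obtain ⟨hN, hs, hu, hv, hw, hk⟩ := (he ξ).1 hd
      have h3 := hp ξ hd
      obtain ⟨c, hc, t, ⟨ht, -⟩ | ⟨ht, -⟩⟩ := (mem_leech_iff ξ).1 hξ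
      · have := ht p
        omega
      · have hx : ∀ i, ξ i = 1 - 2 * ind c i + 4 * nu {p} i := by
          have h0 : ∀ i, ξ i ^ 2 - (1 + 8 * nu {p} i) = 0 := by
            refine eq_zero_of_sum_eq_zero (fun i => ?_) ?_
            · rw [nu_singleton_eq]
              split_ifs with hi
              · rw [hi, h3]
                norm_num
              · have := one_le_sq_of_odd (x := ξ i) (by have := ht i; omega)
                omega
            · rw [Finset.sum_sub_distrib, Finset.sum_add_distrib, sum_one_omega, ← Finset.mul_sum,
                sum_nu_singleton]
              omega
          intro i
          have h1 := ht i
          have h2 := ind_eq_zero_or_one c i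
          have h4 := h0 i
          rw [nu_singleton_eq] at h4 ⊢
          split_ifs at h4 ⊢ with hi
          · rw [hi] at h1 h2 ⊢
            omega
          · have : ξ i = 1 ∨ ξ i = -1 := sq_eq_one_iff.1 (by omega)
            omega
        refine ⟨c, ⟨hc, ?_, ?_, ?_, ?_, ?_⟩, funext fun i => (hx i).symm⟩
        · rw [Finset.sum_congr rfl fun i _ => hx i, hsum] at hs
          omega
        · have := hx inf
          omega
        · have := hx (pt 0)
          omega
        · have := hx (pt 1)
          omega
        · rw [Finset.sum_congr rfl fun i _ => by rw [hx i], hsumK] at hk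
          omega
    · rintro ⟨c, hc', rfl⟩
      have hcp := hpc c hc'
      obtain ⟨hc, h8, hu, hv, hw, hk⟩ := hc'
      refine ⟨(mem_leech_iff _).2 ⟨c, hc, nu {p}, Or.inr ⟨fun i => rfl, ?_⟩⟩, (he _).2
        ⟨?_, ?_, by rw [hu], by rw [hv], by rw [hw], by rw [hsumK, hk]⟩⟩
      · rw [hsum, h8]
        rfl
      · have : ∀ i, (1 - 2 * ind c i + 4 * nu {p} i) ^ 2 =
            1 + 24 * nu {p} i - 16 * (ind c i * nu {p} i) := by
          intro i
          have h1 := ind_mul_self c i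
          have h2 : nu {p} i * nu {p} i = nu {p} i := by
            rw [nu_singleton_eq]
            split_ifs <;> rfl
          linear_combination 4 * h1 + 16 * h2
        rw [Finset.sum_congr rfl fun i _ => this i, Finset.sum_sub_distrib, Finset.sum_add_distrib,
          sum_one_omega, ← Finset.mul_sum, ← Finset.mul_sum, sum_nu_singleton,
          sum_mul_nu_singleton, hcp]
        rfl
      · rw [hsum, h8]
        rfl
  rw [h]
  refine Set.ncard_image_of_injective _ fun c d h => ind_injective (funext fun i => ?_)
  have := congrFun h i
  beta_reduce at this
  omega

lemma ncard_leechLevel_zero : (leechLevel ![0, 0, 0, 0, 0, 0]).ncard = 28 := by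
  -- The equations give `ξ_∞ = ξ_0 = 2`, `ξ_1 = 0` and coordinate sum 16.
  rw [ncard_leechLevel_even (u := 1) (v := 1) (w := 0) (k := 4), ncard_octadWords.1]
  intro ξ
  rw [forall_distA6_iff]
  simp
  omega

lemma ncard_leechLevel_three : (leechLevel ![0, 0, 0, 1, 0, 0]).ncard = 28 := by
  rw [ncard_leechLevel_even (u := 1) (v := 1) (w := 0) (k := 2), ncard_octadWords.2.2.2.2.1]
  intro ξ
  rw [forall_distA6_iff]
  simp
  omega

lemma ncard_leechLevel_five : (leechLevel ![0, 0, 0, 0, 0, 1]).ncard = 7 := by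
  rw [ncard_leechLevel_even (u := 1) (v := 1) (w := 1) (k := 4), ncard_octadWords.2.2.2.2.2]
  intro ξ
  rw [forall_distA6_iff]
  simp
  omega

lemma ncard_leechLevel_first : (leechLevel ![1, 0, 0, 0, 0, 0]).ncard = 7 := by
  have hn : nu {inf} inf = 1 ∧ nu {inf} (pt 0) = 0 ∧ nu {inf} (pt 1) = 0 ∧ nu K0 inf = 0 := by
    decide
  -- The equations give `ξ_∞ = 3`, `ξ_0 = 1`, `ξ_1 = -1` and coordinate sum 12.
  rw [ncard_leechLevel_odd (u := 1) (v := 0) (w := 1) (k := 0) inf, ncard_octadWords.2.1]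
  · intro ξ
    rw [forall_distA6_iff]
    simp [hn]
    omega
  · intro ξ
    rw [forall_distA6_iff]
    simp
    omega
  · rintro c ⟨-, -, h, -⟩
    exact h

lemma ncard_leechLevel_two : (leechLevel ![0, 0, 1, 0, 0, 0]).ncard = 28 := by
  have hn : nu {pt 0} inf = 0 ∧ nu {pt 0} (pt 0) = 1 ∧ nu {pt 0} (pt 1) = 0 ∧ nu K0 (pt 0) = 1 := by
    decide
  rw [ncard_leechLevel_odd (u := 0) (v := 1) (w := 1) (k := 2) (pt 0), ncard_octadWords.2.2.2.1]
  · intro ξ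
    rw [forall_distA6_iff]
    simp [hn]
    omega
  · intro ξ
    rw [forall_distA6_iff]
    simp
    omega
  · rintro c ⟨-, -, -, h, -⟩
    exact h

/-- Here `ξ_∞ = ξ_0 = ξ_1 = 1`, the coordinate sum is 20 and `∑ (ξᵢ - 1)² = 16`. A nonzero word `c`
would contribute at least `4·8` to this sum, so `ξ = 1 + 4t` with `∑ tᵢ = -1` and `∑ tᵢ(tᵢ + 1) =
0`: exactly one `tᵢ` is `-1`. Its position avoids `K0`, `∞` and 1, which leaves `24 - 10` points. -/
lemma ncard_leechLevel_four : (leechLevel ![0, 0, 0, 0, 1, 0]).ncard = 14 := by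
  have hK : ∑ i, nu K0 i = 8 := by decide
  have h0 : pt 0 ∈ K0 := by decide
  have h : leechLevel ![0, 0, 0, 0, 1, 0] =
      (fun p i => 1 - 4 * nu {p} i) '' (((K0 ∪ {inf, pt 1})ᶜ : Finset Omega) : Set Omega) := by
    ext ξ
    simp only [leechLevel, Set.mem_ofPred_eq, Set.mem_image, forall_distA6_iff]
    constructor
    · rintro ⟨hξ, hd⟩
      simp at hd
      obtain ⟨hN, hv, hu, hk, huv, hw⟩ := hd
      obtain ⟨c, hc, t, ⟨ht, -⟩ | ⟨ht, -⟩⟩ := (mem_leech_iff ξ).1 hξ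
      · have := ht inf
        omega
      · have hle : 4 * ∑ i, ind c i ≤ ∑ i, (ξ i - 1) ^ 2 := by
          rw [Finset.mul_sum]
          refine Finset.sum_le_sum fun i _ => ?_
          rcases ind_eq_zero_or_one c i with h | h
          · rw [h]
            positivity
          · have h1 : ξ i - 1 = 2 * (2 * t i - 1) := by rw [ht, h]; ring
            have h2 := one_le_sq_of_odd (x := 2 * t i - 1) (by omega)
            rw [h1, h, mul_pow]
            omega
        have hsq : ∑ i, (ξ i - 1) ^ 2 = ∑ i, ξ i ^ 2 - 2 * ∑ i, ξ i + ∑ _i : Omega, 1 := by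
          rw [Finset.mul_sum, ← Finset.sum_sub_distrib, ← Finset.sum_add_distrib]
          exact Finset.sum_congr rfl fun i _ => by ring
        rw [sum_one_omega] at hsq
        have hW := golay_weight hc
        have hz : ∀ i, ind c i = 0 := eq_zero_of_sum_eq_zero (fun i => by
          rcases ind_eq_zero_or_one c i with h | h <;> omega) (by omega)
        have hx : ∀ i, ξ i = 1 + 4 * t i := fun i => by rw [ht, hz]; ring
        have hS : ∑ i, ξ i = 24 + 4 * ∑ i, t i := by
          rw [← sum_one_omega, Finset.mul_sum, ← Finset.sum_add_distrib]
          exact Finset.sum_congr rfl fun i _ => hx i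
        have ht2 : 16 * ∑ i, t i * (t i + 1) = ∑ i, (ξ i - 1) ^ 2 + 16 * ∑ i, t i := by
          rw [Finset.mul_sum, Finset.mul_sum, ← Finset.sum_add_distrib]
          exact Finset.sum_congr rfl fun i _ => by rw [hx]; ring
        have h01 : ∀ i, t i * (t i + 1) = 0 := by
          refine eq_zero_of_sum_eq_zero (fun i => ?_) (by omega)
          rcases lt_or_ge (t i) 0 with h | h
          · exact mul_nonneg_of_nonpos_of_nonpos h.le (by omega)
          · positivity
        have hT : ∑ i, t i = -1 := by omega
        obtain ⟨p, hp⟩ : ∃ p, t p ≠ 0 := by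
          by_contra! h
          simp [h] at hT
        have htn : ∀ i, -t i - nu {p} i = 0 := by
          refine eq_zero_of_sum_eq_zero (fun i => ?_) ?_
          · rw [nu_singleton_eq]
            split_ifs with hi
            · have := mul_eq_zero.1 (h01 i)
              rw [hi] at this ⊢
              omega
            · have := mul_eq_zero.1 (h01 i)
              omega
          · rw [Finset.sum_sub_distrib, sum_nu_singleton, Finset.sum_neg_distrib, hT]
            rfl
        have hx' : ∀ i, ξ i = 1 - 4 * nu {p} i := fun i => by
          have := htn i
          rw [hx]
          omega
        refine ⟨p, ?_, funext fun i => (hx' i).symm⟩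
        have e1 := hx' inf
        have e2 := hx' (pt 1)
        have e3 : ∑ i, ξ i * nu K0 i = 8 - 4 * nu K0 p := by
          rw [← hK, ← sum_mul_nu_singleton (nu K0), Finset.mul_sum, ← Finset.sum_sub_distrib]
          exact Finset.sum_congr rfl fun i _ => by rw [hx']; ring
        rw [nu_singleton_eq] at e1 e2
        simp only [Finset.coe_compl, Set.mem_compl_iff, Finset.mem_coe, Finset.mem_union,
          Finset.mem_insert, Finset.mem_singleton, not_or]
        refine ⟨fun h => ?_, fun h => ?_, fun h => ?_⟩
        · rw [nu, if_pos h] at e3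
          omega
        · rw [if_pos h.symm] at e1
          omega
        · rw [if_pos h.symm] at e2
          omega
    · rintro ⟨p, hp, rfl⟩
      simp only [Finset.coe_compl, Set.mem_compl_iff, Finset.mem_coe, Finset.mem_union,
        Finset.mem_insert, Finset.mem_singleton, not_or] at hp
      obtain ⟨hpK, hpi, hp1⟩ := hp
      have hp0 : p ≠ pt 0 := by
        rintro rfl
        exact hpK h0
      have hs : ∑ i, (1 - 4 * nu {p} i) = 20 := by
        rw [Finset.sum_sub_distrib, sum_one_omega, ← Finset.mul_sum, sum_nu_singleton]
        rfl
      have hN : ∑ i, (1 - 4 * nu {p} i) ^ 2 = 32 := by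
        have : ∀ i, (1 - 4 * nu {p} i) ^ 2 = 1 + 8 * nu {p} i := fun i => by
          rw [nu_singleton_eq]
          split_ifs <;> rfl
        rw [Finset.sum_congr rfl fun i _ => this i, Finset.sum_add_distrib, sum_one_omega,
          ← Finset.mul_sum, sum_nu_singleton]
        rfl
      have hk : ∑ i, (1 - 4 * nu {p} i) * nu K0 i = 8 := by
        have : ∑ i, (1 - 4 * nu {p} i) * nu K0 i = 8 - 4 * nu K0 p := by
          rw [← hK, ← sum_mul_nu_singleton (nu K0), Finset.mul_sum, ← Finset.sum_sub_distrib]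
          exact Finset.sum_congr rfl fun i _ => by ring
        rw [this, nu, if_neg hpK]
        rfl
      refine ⟨(mem_leech_iff _).2 ⟨0, golay.zero_mem, fun i => -nu {p} i, Or.inr ⟨fun i => ?_, ?_⟩⟩,
        ?_⟩
      · simp [ind]
        ring
      · rw [hs]
        rfl
      · beta_reduce
        rw [hs, hN, hk, nu_singleton_eq, nu_singleton_eq, nu_singleton_eq, if_neg (Ne.symm hpi),
          if_neg (Ne.symm hp1), if_neg hp0.symm]
        simp
  rw [h, Set.ncard_image_of_injective, Set.ncard_coe_finset]
  · decide
  · intro p q h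
    have := congrFun h p
    beta_reduce at this
    rw [nu_singleton_eq, nu_singleton_eq, if_pos rfl] at this
    by_contra hpq
    rw [if_neg hpq] at this
    omega

/-- The equations give `ξ_∞ = ξ_0 = 3`, `ξ_1 = -1`, coordinate sum 20 and sum 12 over `K0`. The
entries turn out to be 1 or 3 on `K0` and `±1` elsewhere, except at `∞`; the coordinates congruent
to 3 modulo 4 form an octad. -/
lemma ncard_leechLevel_one : (leechLevel ![0, 1, 0, 0, 0, 0]).ncard = 14 := by
  have hK : ∑ i, nu K0 i = 8 := by decide
  have hKinf : nu K0 inf = 0 := by decide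
  have hK0 : nu K0 (pt 0) = 1 := by decide
  have hK1 : nu K0 (pt 1) = 0 := by decide
  have hn : nu {inf} inf = 1 ∧ nu {inf} (pt 0) = 0 ∧ nu {inf} (pt 1) = 0 := by decide
  have hK01 : ∀ i, nu K0 i = 0 ∨ nu K0 i = 1 := by decide
  have hsum : ∀ o : Omega → ℤ, ∑ i, (1 - 2 * o i + 4 * (o i * nu K0 i) + 4 * nu {inf} i) =
      28 - 2 * ∑ i, o i + 4 * ∑ i, o i * nu K0 i := by
    intro o
    rw [Finset.sum_add_distrib, Finset.sum_add_distrib, Finset.sum_sub_distrib, sum_one_omega,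
      ← Finset.mul_sum, ← Finset.mul_sum, ← Finset.mul_sum, sum_nu_singleton]
    ring
  have hsumK : ∀ o : Omega → ℤ,
      ∑ i, (1 - 2 * o i + 4 * (o i * nu K0 i) + 4 * nu {inf} i) * nu K0 i =
        8 + 2 * ∑ i, o i * nu K0 i := by
    intro o
    have : ∑ i, (1 - 2 * o i + 4 * (o i * nu K0 i) + 4 * nu {inf} i) * nu K0 i =
        8 + 2 * ∑ i, o i * nu K0 i + 4 * nu K0 inf := by
      rw [← hK, ← sum_mul_nu_singleton (nu K0) inf, Finset.mul_sum, Finset.mul_sum,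
        ← Finset.sum_add_distrib, ← Finset.sum_add_distrib]
      refine Finset.sum_congr rfl fun i _ => ?_
      rcases hK01 i with h | h <;> rw [h] <;> ring
    rw [this, hKinf, mul_zero, add_zero]
  have h : leechLevel ![0, 1, 0, 0, 0, 0] =
      (fun c i => 1 - 2 * ind c i + 4 * (ind c i * nu K0 i) + 4 * nu {inf} i) ''
        octadWords 1 1 1 2 := by
    ext ξ
    simp only [leechLevel, Set.mem_ofPred_eq, Set.mem_image, forall_distA6_iff]
    constructor
    · rintro ⟨hξ, hd⟩
      simp at hd
      obtain ⟨hN, hv, hu, hk, huv, hw⟩ := hd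
      obtain ⟨c, hc, t, ⟨ht, -⟩ | ⟨ht, -⟩⟩ := (mem_leech_iff ξ).1 hξ
      · have := ht inf
        omega
      · have hx : ∀ i, ξ i = 1 - 2 * ind c i + 4 * (ind c i * nu K0 i) + 4 * nu {inf} i := by
          -- The terms are `(ξᵢ - 1)(ξᵢ - 3)` on `K0` and `ξᵢ² - 1` off it, lowered by 8 at `∞`. All
          -- are nonnegative for odd entries with `ξ_∞ = 3`, and they add up to `48 - 4·12 + 3·8 -
          -- 16 - 8 = 0`.
          have h0 : ∀ i, nu K0 i * ((ξ i - 1) * (ξ i - 3)) +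
              (1 - nu K0 i) * (ξ i ^ 2 - 1 - 8 * nu {inf} i) = 0 := by
            refine eq_zero_of_sum_eq_zero (fun i => ?_) ?_
            · have h1 := ht i
              rcases hK01 i with h | h
              · have h2 := one_le_sq_of_odd (x := ξ i) (by omega)
                rw [h, nu_singleton_eq]
                split_ifs with hi
                · rw [hi, show ξ inf = 3 by omega]
                  norm_num
                · linarith
              · rw [h]
                rcases le_or_gt (ξ i) 1 with h2 | h2
                · have := mul_nonneg_of_nonpos_of_nonpos (a := ξ i - 1) (b := ξ i - 3)
                    (by omega) (by omega)
                  linarith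
                · have := mul_nonneg (a := ξ i - 1) (b := ξ i - 3) (by omega) (by omega)
                  linarith
            · have : ∀ i, nu K0 i * ((ξ i - 1) * (ξ i - 3)) +
                  (1 - nu K0 i) * (ξ i ^ 2 - 1 - 8 * nu {inf} i) =
                  ξ i ^ 2 - 4 * (ξ i * nu K0 i) + 4 * nu K0 i - 1 - 8 * nu {inf} i +
                    8 * (nu K0 i * nu {inf} i) := fun i => by ring
              rw [Finset.sum_congr rfl fun i _ => this i, Finset.sum_add_distrib,
                Finset.sum_sub_distrib, Finset.sum_sub_distrib, Finset.sum_add_distrib,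
                Finset.sum_sub_distrib, sum_one_omega, ← Finset.mul_sum, ← Finset.mul_sum,
                ← Finset.mul_sum, ← Finset.mul_sum, sum_mul_nu_singleton, sum_nu_singleton, hKinf,
                hK]
              omega
          intro i
          have h1 := ht i
          have h2 := ind_eq_zero_or_one c i
          have h3 := h0 i
          rcases hK01 i with h | h
          · rw [h, nu_singleton_eq] at h3
            rw [h, nu_singleton_eq]
            split_ifs at h3 ⊢ with hi
            · rw [hi] at h1 h2 ⊢
              omega
            · have : ξ i = 1 ∨ ξ i = -1 := sq_eq_one_iff.1 (by linarith)
              omega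
          · have hi : i ≠ inf := by
              rintro rfl
              omega
            have h4 : (ξ i - 1) * (ξ i - 3) = 0 := by
              rw [h] at h3
              linarith
            rw [h, nu_singleton_eq, if_neg hi]
            rcases mul_eq_zero.1 h4 with h5 | h5 <;> omega
        rw [Finset.sum_congr rfl fun i _ => by rw [hx i], hsumK] at hk
        have hs : ∑ i, ξ i = 20 := by omega
        rw [Finset.sum_congr rfl fun i _ => hx i, hsum] at hs
        refine ⟨c, ⟨hc, ?_, ?_, ?_, ?_, ?_⟩, funext fun i => (hx i).symm⟩
        · omega
        · have := hx inf
          rw [hKinf] at this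
          omega
        · have := hx (pt 0)
          rw [hK0] at this
          omega
        · have := hx (pt 1)
          rw [hK1] at this
          omega
        · omega
    · rintro ⟨c, ⟨hc, h8, hu, hv, hw, hk⟩, rfl⟩
      have hN : ∑ i, (1 - 2 * ind c i + 4 * (ind c i * nu K0 i) + 4 * nu {inf} i) ^ 2 = 48 := by
        have : ∀ i, (1 - 2 * ind c i + 4 * (ind c i * nu K0 i) + 4 * nu {inf} i) ^ 2 =
            1 + 8 * (ind c i * nu K0 i) + 24 * nu {inf} i - 16 * (ind c i * nu {inf} i) := by
          intro i
          rw [nu_singleton_eq]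
          split_ifs with hi
          · rw [hi, hKinf, hu]
            rfl
          · rcases hK01 i with h | h <;> rcases ind_eq_zero_or_one c i with h' | h' <;>
              rw [h, h'] <;> rfl
        rw [Finset.sum_congr rfl fun i _ => this i, Finset.sum_sub_distrib, Finset.sum_add_distrib,
          Finset.sum_add_distrib, sum_one_omega, ← Finset.mul_sum, ← Finset.mul_sum,
          ← Finset.mul_sum, sum_mul_nu_singleton, sum_nu_singleton, hu, hk]
        rfl
      refine ⟨(mem_leech_iff _).2 ⟨c, hc, fun i => ind c i * nu K0 i + nu {inf} i,
        Or.inr ⟨fun i => by ring, ?_⟩⟩, ?_⟩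
      · rw [hsum, h8, hk]
        rfl
      · beta_reduce
        rw [hsum, hN, hsumK, h8, hk, hu, hv, hw, hKinf, hK0, hK1, hn.1, hn.2.1, hn.2.2]
        simp
  rw [h, Set.ncard_image_of_injective, ncard_octadWords.2.2.1]
  refine fun c d h => ind_injective (funext fun i => ?_)
  have := congrFun h i
  beta_reduce at this
  rcases hK01 i with h | h <;> rw [h] at this <;> omega

/-! ### Inner products of Leech roots -/

/-- The word of the octad `K0`. -/
lemma K0_mem_golay : toWord K0Mask ∈ golay := by
  rw [golay_eq_basisCode]
  have : toWord K0Mask =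
      ∑ l : Fin 12, toWord K0Mask (pt (l : ℕ)) • toWord (basisMask l) := by
    decide +kernel
  rw [this]
  exact Submodule.sum_mem _ fun l _ => Submodule.smul_mem _ _ (toWord_mem_basisCode l)

lemma a6Vector_mem_leech (j : Fin 6) : a6Vector j ∈ leech := by
  rw [mem_leech_iff]
  fin_cases j
  · exact ⟨0, golay.zero_mem, nu {pt 0}, Or.inr (by decide)⟩
  · exact ⟨0, golay.zero_mem, 0, Or.inl (by decide)⟩
  · exact ⟨0, golay.zero_mem, nu {inf}, Or.inr (by decide)⟩
  · exact ⟨_, K0_mem_golay, 0, Or.inl (by decide +kernel)⟩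
  · exact ⟨0, golay.zero_mem, nu {inf} + nu {pt 0}, Or.inl (by decide)⟩
  · exact ⟨0, golay.zero_mem, -nu {pt 1}, Or.inr (by decide)⟩

lemma leechRoot_injective : Function.Injective leechRoot := by
  intro ξ η h
  funext i
  have : toReal ξ i = toReal η i := by
    have := congrArg (fun v : V => v.2.2 i) h
    exact this
  exact Int.cast_injective this

/-- The first coordinate of `leechRoot ξ` is integral because 16 divides `∑ ξᵢ²`. -/
lemma isLeechRoot_iff (r : V) : IsLeechRoot r ↔ ∃ ξ ∈ leech, r = leechRoot ξ := by
  refine ⟨fun h => h.2, fun h => ⟨?_, h⟩⟩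
  obtain ⟨ξ, hξ, rfl⟩ := h
  obtain ⟨k, hk⟩ : (16 : ℤ) ∣ ∑ i, ξ i ^ 2 := by
    by_cases h0 : ξ = 0
    · simp [h0]
    · exact (leech_norm hξ h0).2
  refine ⟨k - 1, 1, ξ, hξ, ?_⟩
  have : (∑ i, (ξ i : ℝ) ^ 2) = 16 * k := by exact_mod_cast hk
  rw [leechRoot, this]
  congr 1
  · push_cast
    ring
  · norm_num

lemma isLeechRoot_a6Root (j : Fin 6) : IsLeechRoot (a6Root j) :=
  (isLeechRoot_iff _).2 ⟨_, a6Vector_mem_leech j, rfl⟩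

lemma form_leechRoot_self (ξ : Omega → ℤ) : form (leechRoot ξ) (leechRoot ξ) = -2 := by
  rw [form_leechRoot]
  simp

lemma IsLeechRoot.form_self {r : V} (hr : IsLeechRoot r) : form r r = -2 := by
  obtain ⟨ξ, -, rfl⟩ := hr.2
  exact form_leechRoot_self ξ

lemma IsLeechRoot.form_eq_natCast {r s : V} (hr : IsLeechRoot r) (hs : IsLeechRoot s)
    (h : r ≠ s) : ∃ n : ℕ, form r s = n := by
  obtain ⟨ξ, hξ, rfl⟩ := hr.2
  obtain ⟨η, hη, rfl⟩ := hs.2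
  obtain ⟨n, hn⟩ := leech_dist hξ hη (ne_of_apply_ne _ h)
  refine ⟨n, ?_⟩
  rw [form_leechRoot, hn]
  push_cast
  ring

lemma IsLeechRoot.form_nonneg {r s : V} (hr : IsLeechRoot r) (hs : IsLeechRoot s)
    (h : r ≠ s) : 0 ≤ form r s := by
  obtain ⟨n, hn⟩ := hr.form_eq_natCast hs h
  rw [hn]
  positivity

lemma form_weylVector_leechRoot (ξ : Omega → ℤ) : form weylVector (leechRoot ξ) = 1 := by
  simp [form_apply, weylVector, leechRoot]

lemma IsLeechRoot.form_weylVector {r : V} (hr : IsLeechRoot r) : form weylVector r = 1 := by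
  obtain ⟨ξ, -, rfl⟩ := hr.2
  exact form_weylVector_leechRoot ξ

/-- The inner products of `r` with the roots of the `A₆` are the numbers `e j`. -/
def HasPairing (r : V) (e : Fin 6 → ℤ) : Prop := ∀ j, form r (a6Root j) = (e j : ℝ)

lemma hasPairing_leechRoot_iff (ξ : Omega → ℤ) (e : Fin 6 → ℤ) :
    HasPairing (leechRoot ξ) e ↔ ∀ j, distA6 ξ j = 32 + 16 * e j := by
  refine forall_congr' fun j => ?_
  rw [a6Root, form_leechRoot, ← distA6]
  constructor
  · intro h
    have : (distA6 ξ j : ℝ) = ((32 + 16 * e j : ℤ) : ℝ) := by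
      push_cast
      linarith
    exact_mod_cast this
  · intro h
    rw [h]
    push_cast
    ring

lemma IsLeechRoot.exists_hasPairing {r : V} (hr : IsLeechRoot r) (h : r ∉ Set.range a6Root) :
    ∃ e : Fin 6 → ℕ, HasPairing r fun j => e j := by
  choose e he using fun j => hr.form_eq_natCast (isLeechRoot_a6Root j)
    fun h' => h ⟨j, h'.symm⟩
  exact ⟨e, fun j => by rw [he]; norm_cast⟩

/-! ### The orthogonal projection -/

/-- Seven times the inverse of the Cartan matrix of type `A₆`. -/
def adjA6 : Matrix (Fin 6) (Fin 6) ℤ :=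
  Matrix.of fun i j => (min (i : ℤ) j + 1) * (6 - max (i : ℤ) j)

lemma A6_mul_adjA6 : CartanMatrix.A 6 * adjA6 = 7 • 1 := by decide

lemma sum_A6_adjA6 (e : Fin 6 → ℤ) (j : Fin 6) :
    ∑ k, CartanMatrix.A 6 j k * ∑ l, adjA6 k l * e l = 7 * e j := by
  have h : (CartanMatrix.A 6).mulVec (adjA6.mulVec e) = 7 • e := by
    rw [Matrix.mulVec_mulVec, A6_mul_adjA6, Matrix.smul_mulVec, Matrix.one_mulVec]
  have := congrFun h j
  simpa [Matrix.mulVec, dotProduct] using this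

/-- Seven times the norm in the dual of the positive definite `A₆`. -/
def dualNorm (e : Fin 6 → ℤ) : ℤ := ∑ j, e j * ∑ k, adjA6 j k * e k

lemma mem_a6Perp_iff (x : V) : x ∈ a6Perp ↔ ∀ j, form x (a6Root j) = 0 := by
  constructor
  · intro h j
    rw [form_comm]
    exact h _ (Submodule.subset_span ⟨j, rfl⟩)
  · intro h v hv
    change form v x = 0
    induction hv using Submodule.span_induction with
    | mem v hv =>
      obtain ⟨j, rfl⟩ := hv
      rw [form_comm, h]
    | zero => simp
    | add v w _ _ hv hw => rw [map_add, LinearMap.add_apply, hv, hw, add_zero]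
    | smul c v _ hv => rw [map_smul, LinearMap.smul_apply, hv, smul_zero]

lemma form_of_mem_a6Perp {x v : V} (hx : x ∈ a6Perp) (hv : v ∈ a6Span) : form x v = 0 := by
  rw [form_comm]
  exact hx v hv

lemma a6Root_mem_a6Span (j : Fin 6) : a6Root j ∈ a6Span := Submodule.subset_span ⟨j, rfl⟩

lemma proj_mem (r : V) : proj r ∈ a6Perp := Submodule.projection_apply_mem _ _

lemma sub_proj_mem (r : V) : r - proj r ∈ a6Span := Submodule.sub_projection_mem _ _

lemma proj_of_mem_a6Span {v : V} (hv : v ∈ a6Span) : proj v = 0 :=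
  (Submodule.projection_apply_eq_zero_iff isCompl_a6).2 hv

lemma proj_of_mem_a6Perp {v : V} (hv : v ∈ a6Perp) : proj v = v :=
  Submodule.projection_apply_of_mem_left isCompl_a6 hv

lemma form_proj_right {x : V} (hx : x ∈ a6Perp) (r : V) : form x (proj r) = form x r := by
  have := form_of_mem_a6Perp hx (sub_proj_mem r)
  rw [map_sub] at this
  linarith

/-- The right side is orthogonal to the diagram because the Gram matrix of the six roots is `-A` and
`A * adjA6 = 7`. The factor 7 keeps all coefficients integral, so the vector lies in the lattice
generated by `A₆` and `r`. -/
lemma seven_smul_proj {r : V} {e : Fin 6 → ℤ} (he : HasPairing r e) :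
    (7 : ℝ) • proj r = (7 : ℝ) • r + ∑ j, ((∑ k, adjA6 j k * e k : ℤ) : ℝ) • a6Root j := by
  have hs : ∑ j, ((∑ k, adjA6 j k * e k : ℤ) : ℝ) • a6Root j ∈ a6Span :=
    Submodule.sum_mem _ fun j _ => Submodule.smul_mem _ _ (a6Root_mem_a6Span j)
  have hp : (7 : ℝ) • r + ∑ j, ((∑ k, adjA6 j k * e k : ℤ) : ℝ) • a6Root j ∈ a6Perp := by
    rw [mem_a6Perp_iff]
    intro j
    simp only [map_add, map_sum, map_smul, LinearMap.add_apply, LinearMap.sum_apply,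
      LinearMap.smul_apply, smul_eq_mul, he j]
    have h : ∀ k, form (a6Root k) (a6Root j) = -((CartanMatrix.A 6 j k : ℤ) : ℝ) := fun k => by
      rw [form_comm, form_a6Root]
    simp only [h]
    have := sum_A6_adjA6 e j
    have h2 : (∑ k, (CartanMatrix.A 6 j k : ℝ) * ((∑ l, adjA6 k l * e l : ℤ) : ℝ)) = 7 * e j := by
      exact_mod_cast this
    rw [← h2, ← Finset.sum_add_distrib]
    exact Finset.sum_eq_zero fun k _ => by ring
  rw [← map_smul, ← proj_of_mem_a6Perp hp, map_add, proj_of_mem_a6Span hs, add_zero]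

lemma form_proj_left {r s : V} {e e' : Fin 6 → ℤ} (he : HasPairing r e) (he' : HasPairing s e') :
    form (proj r) s = form r s + ((∑ j, e' j * ∑ k, adjA6 j k * e k : ℤ) : ℝ) / 7 := by
  have h := congrArg (fun v => form v s) (seven_smul_proj he)
  simp only [map_add, map_sum, map_smul, LinearMap.add_apply, LinearMap.sum_apply,
    LinearMap.smul_apply, smul_eq_mul, form_comm (a6Root _) s, he' _] at h
  have h2 : ((∑ j, e' j * ∑ k, adjA6 j k * e k : ℤ) : ℝ) =
      ∑ j, ((∑ k, adjA6 j k * e k : ℤ) : ℝ) * (e' j : ℝ) := by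
    push_cast
    exact Finset.sum_congr rfl fun j _ => by ring
  rw [h2]
  linarith

lemma form_proj_self {r : V} {e : Fin 6 → ℤ} (he : HasPairing r e) :
    form (proj r) (proj r) = form r r + (dualNorm e : ℝ) / 7 := by
  rw [form_proj_right (proj_mem r), form_proj_left he he]
  rfl

lemma adjA6_pos (j k : Fin 6) : 0 < adjA6 j k := by
  have : ∀ j k : Fin 6, 0 < (min (j : ℤ) k + 1) * (6 - max (j : ℤ) k) := by decide
  exact this j k

/-- Projecting adds `e'ᵀA⁻¹e` to `⟨r,s⟩`, and all entries of `A⁻¹` are positive. This is what keeps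
the walls of `D'` at non-obtuse interior angles. -/
lemma form_proj_nonneg {r s : V} (hr : IsLeechRoot r) (hs : IsLeechRoot s) (h : r ≠ s)
    (hr' : r ∉ Set.range a6Root) (hs' : s ∉ Set.range a6Root) : 0 ≤ form (proj r) s := by
  obtain ⟨e, he⟩ := hr.exists_hasPairing hr'
  obtain ⟨e', he'⟩ := hs.exists_hasPairing hs'
  rw [form_proj_left he he']
  have h1 := hr.form_nonneg hs h
  have h2 : 0 ≤ ∑ j, (e' j : ℤ) * ∑ k, adjA6 j k * (e k : ℤ) :=
    Finset.sum_nonneg fun j _ => mul_nonneg (by positivity) <| Finset.sum_nonneg fun k _ =>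
      mul_nonneg (adjA6_pos j k).le (by positivity)
  have h3 : (0 : ℝ) ≤ ((∑ j, (e' j : ℤ) * ∑ k, adjA6 j k * (e k : ℤ) : ℤ) : ℝ) := by
    exact_mod_cast h2
  positivity

/-- The diagonal entries of `adjA6` are at least 6, so one entry `e j ≥ 2` already contributes 24.
The 64 vectors with entries 0 and 1 remain; the two ends together give exactly 14, the affine
diagram of type `A₆`. -/
lemma pairing_of_dualNorm_lt {e : Fin 6 → ℕ} (h : dualNorm (fun j => e j) < 14) :
    (fun j => (e j : ℤ)) ∈ ({![0, 0, 0, 0, 0, 0], ![1, 0, 0, 0, 0, 0], ![0, 1, 0, 0, 0, 0],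
      ![0, 0, 1, 0, 0, 0], ![0, 0, 0, 1, 0, 0], ![0, 0, 0, 0, 1, 0], ![0, 0, 0, 0, 0, 1]} :
        Finset (Fin 6 → ℤ)) := by
  have hle : ∀ j, e j ≤ 1 := by
    intro j
    by_contra hj
    have h1 : 6 ≤ adjA6 j j := by
      have : ∀ j : Fin 6, 6 ≤ (min (j : ℤ) j + 1) * (6 - max (j : ℤ) j) := by decide
      exact this j
    have h2 : (e j : ℤ) * (adjA6 j j * e j) ≤ dualNorm fun j => e j := by
      refine le_trans ?_ (Finset.single_le_sum (f := fun j => (e j : ℤ) * ∑ k, adjA6 j k * e k)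
        (fun j _ => mul_nonneg (by positivity) <| Finset.sum_nonneg fun k _ =>
          mul_nonneg (adjA6_pos j k).le (by positivity)) (Finset.mem_univ j))
      refine mul_le_mul_of_nonneg_left ?_ (by positivity)
      exact Finset.single_le_sum (f := fun k => adjA6 j k * (e k : ℤ))
        (fun k _ => mul_nonneg (adjA6_pos j k).le (by positivity)) (Finset.mem_univ j)
    have h3 : (2 : ℤ) ≤ e j := by omega
    have h4 : 6 * ((e j : ℤ) * e j) ≤ adjA6 j j * (e j * e j) :=
      mul_le_mul_of_nonneg_right h1 (by positivity)
    nlinarith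
  obtain ⟨f, rfl⟩ : ∃ f : Fin 6 → Fin 2, e = fun j => (f j : ℕ) :=
    ⟨fun j => ⟨e j, by have := hle j; omega⟩, rfl⟩
  revert f
  decide +kernel

/-! ### Determinants of Gram matrices -/

/-- The Cartan matrix of type `A₆`, extended by a root with inner products `e j`. -/
def extCartan (e : Fin 6 → ℤ) : Matrix (Fin 6 ⊕ Fin 1) (Fin 6 ⊕ Fin 1) ℤ :=
  Matrix.fromBlocks (CartanMatrix.A 6) (Matrix.of fun i _ => -e i) (Matrix.of fun _ j => -e j)
    (CartanMatrix.A 1)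

lemma det_A6_ne_zero : (CartanMatrix.A 6).det ≠ 0 := by
  intro h
  have := congrArg Matrix.det A6_mul_adjA6
  rw [Matrix.det_mul, h, zero_mul] at this
  revert this
  decide +kernel

/-- Column elimination: replacing the last column by 7 times itself plus the combination of the
others with coefficients `adjA6 e` clears its first six entries. -/
lemma det_extCartan (e : Fin 6 → ℤ) :
    7 * (extCartan e).det = (CartanMatrix.A 6).det * (14 - dualNorm e) := by
  have h : extCartan e * Matrix.fromBlocks 1 (Matrix.of fun i _ => ∑ k, adjA6 i k * e k) 0
      (Matrix.of fun _ _ => 7) = Matrix.fromBlocks (CartanMatrix.A 6) 0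
        (Matrix.of fun _ j => -e j) (Matrix.of fun _ _ => 14 - dualNorm e) := by
    rw [extCartan, Matrix.fromBlocks_multiply]
    congr 1
    · simp
    · ext i j
      have := sum_A6_adjA6 e i
      simp only [Matrix.add_apply, Matrix.mul_apply, Matrix.of_apply, this, Finset.univ_unique,
        Finset.sum_singleton, Matrix.zero_apply]
      ring
    · simp
    · ext i j
      have h2 : CartanMatrix.A 1 i 0 = 2 := by
        rw [Subsingleton.elim i 0]
        decide
      simp only [Matrix.add_apply, Matrix.mul_apply, Matrix.of_apply, Finset.univ_unique,
        Finset.sum_singleton, neg_mul, Finset.sum_neg_distrib, dualNorm, Fin.default_eq_zero, h2]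
      ring
  have := congrArg Matrix.det h
  rw [Matrix.det_mul, Matrix.det_fromBlocks_zero₂₁, Matrix.det_fromBlocks_zero₁₂, Matrix.det_one,
    Matrix.det_fin_one, Matrix.det_fin_one] at this
  simp only [Matrix.of_apply, one_mul] at this
  linarith

/-- The roots of the `A₆` together with `r`. -/
noncomputable def extFamily (r : V) : Fin 6 ⊕ Fin 1 → V := Sum.elim a6Root fun _ => r

lemma withA6_eq (r : V) : withA6 r = Submodule.span ℤ (Set.range (extFamily r)) := by
  rw [withA6, extFamily, Set.Sum.elim_range, Set.range_const, Set.union_singleton]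

lemma form_extFamily {r : V} {e : Fin 6 → ℤ} (he : HasPairing r e) (hr : form r r = -2)
    (i j : Fin 6 ⊕ Fin 1) :
    form (extFamily r i) (extFamily r j) = -((extCartan e i j : ℤ) : ℝ) := by
  rcases i with i | i <;> rcases j with j | j
  · simpa [extFamily, extCartan] using form_a6Root i j
  · simpa [extFamily, extCartan, form_comm (a6Root i)] using he i
  · simpa [extFamily, extCartan] using he j
  · have : CartanMatrix.A 1 i j = 2 := by
      rw [Subsingleton.elim i 0, Subsingleton.elim j 0]
      decide
    simp [extFamily, extCartan, hr, this]

lemma linearIndependent_extFamily {r : V} {e : Fin 6 → ℤ} (he : HasPairing r e)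
    (hr : form r r = -2) (h : dualNorm e ≠ 14) : LinearIndependent ℤ (extFamily r) := by
  have hdet : (extCartan e).det ≠ 0 := fun h0 => by
    have := det_extCartan e
    rw [h0, mul_zero, eq_comm, mul_eq_zero] at this
    exact this.elim det_A6_ne_zero fun h' => h (by linarith)
  rw [Fintype.linearIndependent_iff]
  intro c hc
  refine congrFun (Matrix.eq_zero_of_mulVec_eq_zero hdet (v := c) (funext fun i => ?_))
  have := congrArg (form (extFamily r i)) hc
  simp only [← Int.cast_smul_eq_zsmul ℝ, map_sum, map_smul, form_extFamily he hr, smul_eq_mul,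
    map_zero] at this
  have h2 : ((∑ j, extCartan e i j * c j : ℤ) : ℝ) = 0 := by
    push_cast
    rw [← neg_eq_zero, ← this, ← Finset.sum_neg_distrib]
    exact Finset.sum_congr rfl fun j _ => by ring
  exact_mod_cast h2

lemma hasRootType_of_equiv {ι : Type} {C : Matrix ι ι ℤ} {r : V} {e : Fin 6 → ℤ}
    (he : HasPairing r e) (hr : form r r = -2) (h : dualNorm e ≠ 14) (σ : ι ≃ Fin 6 ⊕ Fin 1)
    (hC : ∀ i j, C i j = extCartan e (σ i) (σ j)) : HasRootType (withA6 r) C := by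
  rw [withA6_eq]
  refine ⟨(Module.Basis.span (linearIndependent_extFamily he hr h)).reindex σ.symm, fun i j => ?_⟩
  simp only [Module.Basis.reindex_apply, Equiv.symm_symm, Module.Basis.span_apply, hC]
  exact form_extFamily he hr _ _

lemma linearIndependent_of_finrank {r : V} (h : Module.finrank ℤ (withA6 r) = 7) :
    LinearIndependent ℤ (extFamily r) := by
  rw [linearIndependent_iff_card_eq_finrank_span, Set.finrank, ← withA6_eq, h]
  rfl

/-- An isometry type gives some basis, unrelated to the six roots and `r`. Rank 7 makes these seven
generators a basis too, and the change of basis has determinant `±1`, so the Gram determinants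
agree. -/
lemma det_eq_of_hasRootType {ι : Type} [Fintype ι] [DecidableEq ι] {C : Matrix ι ι ℤ} {r : V}
    {e : Fin 6 → ℤ} (he : HasPairing r e) (hr : form r r = -2) (σ : ι ≃ Fin 6 ⊕ Fin 1)
    (hC : HasRootType (withA6 r) C) : C.det = (extCartan e).det := by
  rw [withA6_eq] at hC
  obtain ⟨b, hb⟩ := hC
  have hli : LinearIndependent ℤ (extFamily r) := by
    apply linearIndependent_of_finrank
    rw [withA6_eq, Module.finrank_eq_card_basis b, Fintype.card_congr σ]
    rfl
  set b' := (Module.Basis.span hli).reindex σ.symm with hb'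
  have hb'' : ∀ i, (b' i : V) = extFamily r (σ i) := fun i => by
    simp [hb', Module.Basis.span_apply]
  set P := b'.toMatrix b with hP
  have hdet : P.det * P.det = 1 := by
    have h1 : P.det * (b.toMatrix b').det = 1 := by
      rw [← Matrix.det_mul, Module.Basis.toMatrix_mul_toMatrix_flip, Matrix.det_one]
    rcases Int.eq_one_or_neg_one_of_mul_eq_one h1 with h | h <;> rw [h] <;> rfl
  have hmat : C = P.transpose * (extCartan e).submatrix σ σ * P := by
    ext i j
    have hsum : ∀ i, (b i : V) = ∑ k, P k i • extFamily r (σ k) := fun i => by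
      have := congrArg Subtype.val (b'.sum_toMatrix_smul_self b i)
      simp only [Submodule.coe_sum, Submodule.coe_smul, hb''] at this
      exact this.symm
    have h1 := hb i j
    rw [hsum, hsum] at h1
    simp only [← Int.cast_smul_eq_zsmul ℝ, map_sum, map_smul, LinearMap.sum_apply,
      LinearMap.smul_apply, form_extFamily he hr, smul_eq_mul] at h1
    have h2 : ((C i j : ℤ) : ℝ) =
        ((∑ l, (∑ k, P k i * extCartan e (σ k) (σ l)) * P l j : ℤ) : ℝ) := by
      rw [← neg_inj, ← h1]
      push_cast
      rw [← Finset.sum_neg_distrib]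
      refine Finset.sum_congr rfl fun l _ => ?_
      rw [Finset.sum_mul, ← Finset.sum_neg_distrib, Finset.mul_sum]
      exact Finset.sum_congr rfl fun k _ => by ring
    have h3 : C i j = ∑ l, (∑ k, P k i * extCartan e (σ k) (σ l)) * P l j := by exact_mod_cast h2
    simp only [h3, Matrix.mul_apply, Matrix.transpose_apply, Matrix.submatrix_apply]
  rw [hmat, Matrix.det_mul, Matrix.det_mul, Matrix.det_transpose, Matrix.det_submatrix_equiv_self,
    mul_right_comm, hdet, one_mul]

/-! ### Types of the root lattices -/

/-- The vectors of inner products for which the extended diagram is spherical. -/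
def sphericalPairings : Finset (Fin 6 → ℤ) :=
  {![0, 0, 0, 0, 0, 0], ![1, 0, 0, 0, 0, 0], ![0, 1, 0, 0, 0, 0], ![0, 0, 1, 0, 0, 0],
    ![0, 0, 0, 1, 0, 0], ![0, 0, 0, 0, 1, 0], ![0, 0, 0, 0, 0, 1]}

/-- The matrix `C` is a reordering of the Cartan matrix of type `A₆` extended by a root with
inner products `e j`. -/
def IsExtension {ι : Type} (C : Matrix ι ι ℤ) (e : Fin 6 → ℤ) : Prop :=
  ∃ σ : ι ≃ Fin 6 ⊕ Fin 1, C = (extCartan e).submatrix σ σ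

lemma isExtension_of_bijective {C : Matrix (Fin 7) (Fin 7) ℤ} {e : Fin 6 → ℤ}
    (f : Fin 7 → Fin 6 ⊕ Fin 1) (hf : Function.Bijective f)
    (h : C = (extCartan e).submatrix f f) : IsExtension C e :=
  ⟨Equiv.ofBijective f hf, h⟩

lemma isExtension_A6A1 : IsExtension cartanA6A1 ![0, 0, 0, 0, 0, 0] :=
  ⟨Equiv.refl _, by decide⟩

lemma isExtension_A7_left : IsExtension (CartanMatrix.A 7) ![1, 0, 0, 0, 0, 0] :=
  isExtension_of_bijective ![.inr 0, .inl 0, .inl 1, .inl 2, .inl 3, .inl 4, .inl 5]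
    (by decide) (by decide)

lemma isExtension_A7_right : IsExtension (CartanMatrix.A 7) ![0, 0, 0, 0, 0, 1] :=
  isExtension_of_bijective ![.inl 0, .inl 1, .inl 2, .inl 3, .inl 4, .inl 5, .inr 0]
    (by decide) (by decide)

lemma isExtension_D7_left : IsExtension (CartanMatrix.D 7) ![0, 1, 0, 0, 0, 0] :=
  isExtension_of_bijective ![.inl 5, .inl 4, .inl 3, .inl 2, .inl 1, .inl 0, .inr 0]
    (by decide) (by decide)

lemma isExtension_D7_right : IsExtension (CartanMatrix.D 7) ![0, 0, 0, 0, 1, 0] :=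
  isExtension_of_bijective ![.inl 0, .inl 1, .inl 2, .inl 3, .inl 4, .inl 5, .inr 0]
    (by decide) (by decide)

lemma isExtension_E7_left : IsExtension CartanMatrix.E₇ ![0, 0, 1, 0, 0, 0] :=
  -- In Bourbaki's numbering, counted from 0, node 1 is the short arm, attached to node 3; so `r`
  -- takes place 1 and its neighbour in the path takes place 3.
  isExtension_of_bijective ![.inl 0, .inr 0, .inl 1, .inl 2, .inl 3, .inl 4, .inl 5]
    (by decide) (by decide)

lemma isExtension_E7_right : IsExtension CartanMatrix.E₇ ![0, 0, 0, 1, 0, 0] :=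
  isExtension_of_bijective ![.inl 5, .inr 0, .inl 4, .inl 3, .inl 2, .inl 1, .inl 0]
    (by decide) (by decide)

lemma dualNorm_eq_of_hasRootType {ι : Type} {C : Matrix ι ι ℤ} {r : V} {e e' : Fin 6 → ℤ}
    (he : HasPairing r e) (hr : form r r = -2) (hC : IsExtension C e')
    (h : HasRootType (withA6 r) C) : dualNorm e = dualNorm e' := by
  obtain ⟨σ, rfl⟩ := hC
  have := Fintype.ofEquiv _ σ.symm
  have := Classical.decEq ι
  have h1 := det_eq_of_hasRootType he hr σ h
  rw [Matrix.det_submatrix_equiv_self] at h1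
  have h3 := det_extCartan e
  rw [← h1, det_extCartan] at h3
  have := mul_left_cancel₀ det_A6_ne_zero h3
  linarith

lemma IsLeechRoot.exists_hasPairing_int {r : V} (hr : IsLeechRoot r) :
    ∃ e : Fin 6 → ℤ, HasPairing r e := by
  by_cases h : r ∈ Set.range a6Root
  · obtain ⟨k, rfl⟩ := h
    exact ⟨fun j => -CartanMatrix.A 6 k j, fun j => by rw [form_a6Root]; push_cast; rfl⟩
  · obtain ⟨e, he⟩ := hr.exists_hasPairing h
    exact ⟨_, he⟩

lemma form_proj_of_hasRootType {ι : Type} {C : Matrix ι ι ℤ} {r : V} {e : Fin 6 → ℤ}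
    (hr : IsLeechRoot r) (hC : IsExtension C e) (h : HasRootType (withA6 r) C) :
    form (proj r) (proj r) = -2 + (dualNorm e : ℝ) / 7 := by
  obtain ⟨e', he'⟩ := hr.exists_hasPairing_int
  rw [form_proj_self he', hr.form_self, dualNorm_eq_of_hasRootType he' hr.form_self hC h]

lemma not_mem_range_of_form_proj_neg {r : V} (h : form (proj r) (proj r) < 0) :
    r ∉ Set.range a6Root := by
  rintro ⟨j, rfl⟩
  rw [proj_of_mem_a6Span (a6Root_mem_a6Span j)] at h
  simp at h

lemma exists_pairing_of_form_proj_neg {r : V} (hr : IsLeechRoot r)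
    (h : form (proj r) (proj r) < 0) : ∃ e ∈ sphericalPairings, HasPairing r e := by
  obtain ⟨e, he⟩ := hr.exists_hasPairing (not_mem_range_of_form_proj_neg h)
  refine ⟨_, pairing_of_dualNorm_lt ?_, he⟩
  rw [form_proj_self he, hr.form_self] at h
  have : (dualNorm (fun j => (e j : ℤ)) : ℝ) < ((14 : ℤ) : ℝ) := by
    push_cast
    linarith
  exact_mod_cast this

lemma dualNorm_lt_of_mem {e : Fin 6 → ℤ} (h : e ∈ sphericalPairings) : dualNorm e < 14 := by
  have : ∀ e ∈ sphericalPairings, dualNorm e < 14 := by decide +kernel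
  exact this e h

lemma hasRootType_of_isExtension {ι : Type} {C : Matrix ι ι ℤ} {r : V} {e : Fin 6 → ℤ}
    (he : HasPairing r e) (hr : form r r = -2) (h : e ∈ sphericalPairings)
    (hC : IsExtension C e) : HasRootType (withA6 r) C := by
  obtain ⟨σ, rfl⟩ := hC
  exact hasRootType_of_equiv he hr (dualNorm_lt_of_mem h).ne σ fun _ _ => rfl

/-- The reflection of the path gives two positions of the new node for each connected type; for `A₆
⊕ A₁` they coincide and `e₁ = e₂`. The type yields only the value of `dualNorm`, and `h` recovers
`e` from it among the spherical pairings. -/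
lemma setOf_hasRootType {ι : Type} {C : Matrix ι ι ℤ} {e₁ e₂ : Fin 6 → ℤ}
    (h₁ : e₁ ∈ sphericalPairings) (h₂ : e₂ ∈ sphericalPairings)
    (hC₁ : IsExtension C e₁) (hC₂ : IsExtension C e₂)
    (h : ∀ e ∈ sphericalPairings, dualNorm e = dualNorm e₁ → e = e₁ ∨ e = e₂) :
    {r : V | IsLeechRoot r ∧ HasRootType (withA6 r) C} =
      leechRoot '' (leechLevel e₁ ∪ leechLevel e₂) := by
  ext r
  constructor
  · rintro ⟨hr, hT⟩
    have hneg : form (proj r) (proj r) < 0 := by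
      rw [form_proj_of_hasRootType hr hC₁ hT]
      have : (dualNorm e₁ : ℝ) < ((14 : ℤ) : ℝ) := by exact_mod_cast dualNorm_lt_of_mem h₁
      push_cast at this
      linarith
    obtain ⟨e, hes, he⟩ := exists_pairing_of_form_proj_neg hr hneg
    have hd := dualNorm_eq_of_hasRootType he hr.form_self hC₁ hT
    obtain ⟨ξ, hξ, rfl⟩ := (isLeechRoot_iff r).1 hr
    rw [hasPairing_leechRoot_iff] at he
    refine ⟨ξ, ?_, rfl⟩
    rcases h e hes hd with rfl | rfl
    · exact Or.inl ⟨hξ, he⟩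
    · exact Or.inr ⟨hξ, he⟩
  · rintro ⟨ξ, ⟨hξ, he⟩ | ⟨hξ, he⟩, rfl⟩
    · exact ⟨(isLeechRoot_iff _).2 ⟨ξ, hξ, rfl⟩, hasRootType_of_isExtension
        ((hasPairing_leechRoot_iff ξ _).2 he) (form_leechRoot_self ξ) h₁ hC₁⟩
    · exact ⟨(isLeechRoot_iff _).2 ⟨ξ, hξ, rfl⟩, hasRootType_of_isExtension
        ((hasPairing_leechRoot_iff ξ _).2 he) (form_leechRoot_self ξ) h₂ hC₂⟩

lemma ncard_image_leechLevel_union {e₁ e₂ : Fin 6 → ℤ} (h : e₁ ≠ e₂)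
    (h₁ : (leechLevel e₁).ncard ≠ 0) (h₂ : (leechLevel e₂).ncard ≠ 0) :
    (leechRoot '' (leechLevel e₁ ∪ leechLevel e₂)).ncard =
      (leechLevel e₁).ncard + (leechLevel e₂).ncard := by
  rw [Set.ncard_image_of_injective _ leechRoot_injective]
  refine Set.ncard_union_eq (Set.disjoint_left.2 fun ξ hξ hξ' => h (funext fun j => ?_))
    (Set.finite_of_ncard_ne_zero h₁) (Set.finite_of_ncard_ne_zero h₂)
  have h1 := hξ.2 j
  have h2 := hξ'.2 j
  omega

lemma ncard_A6A1 : {r : V | IsLeechRoot r ∧ HasRootType (withA6 r) cartanA6A1}.ncard = 28 := by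
  rw [setOf_hasRootType (by decide +kernel) (by decide +kernel) isExtension_A6A1 isExtension_A6A1
    (by decide +kernel), Set.union_self, Set.ncard_image_of_injective _ leechRoot_injective,
    ncard_leechLevel_zero]

lemma ncard_A7 :
    {r : V | IsLeechRoot r ∧ HasRootType (withA6 r) (CartanMatrix.A 7)}.ncard = 14 := by
  rw [setOf_hasRootType (by decide +kernel) (by decide +kernel) isExtension_A7_left
    isExtension_A7_right (by decide +kernel), ncard_image_leechLevel_union (by decide),
    ncard_leechLevel_first, ncard_leechLevel_five]
  · simp [ncard_leechLevel_first]
  · simp [ncard_leechLevel_five]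

lemma ncard_D7 :
    {r : V | IsLeechRoot r ∧ HasRootType (withA6 r) (CartanMatrix.D 7)}.ncard = 28 := by
  rw [setOf_hasRootType (by decide +kernel) (by decide +kernel) isExtension_D7_left
    isExtension_D7_right (by decide +kernel), ncard_image_leechLevel_union (by decide),
    ncard_leechLevel_one, ncard_leechLevel_four]
  · simp [ncard_leechLevel_one]
  · simp [ncard_leechLevel_four]

lemma ncard_E7 :
    {r : V | IsLeechRoot r ∧ HasRootType (withA6 r) CartanMatrix.E₇}.ncard = 56 := by
  rw [setOf_hasRootType (by decide +kernel) (by decide +kernel) isExtension_E7_left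
    isExtension_E7_right (by decide +kernel), ncard_image_leechLevel_union (by decide),
    ncard_leechLevel_two, ncard_leechLevel_three]
  · simp [ncard_leechLevel_two]
  · simp [ncard_leechLevel_three]

lemma hasRootType_of_form_proj_neg {r : V} (hr : IsLeechRoot r)
    (h : form (proj r) (proj r) < 0) :
    HasRootType (withA6 r) cartanA6A1 ∨ HasRootType (withA6 r) (CartanMatrix.A 7) ∨
      HasRootType (withA6 r) (CartanMatrix.D 7) ∨ HasRootType (withA6 r) CartanMatrix.E₇ := by
  obtain ⟨e, hes, he⟩ := exists_pairing_of_form_proj_neg hr h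
  have hes' := hes
  simp only [sphericalPairings, Finset.mem_insert, Finset.mem_singleton] at hes'
  rcases hes' with rfl | rfl | rfl | rfl | rfl | rfl | rfl
  · exact Or.inl (hasRootType_of_isExtension he hr.form_self hes isExtension_A6A1)
  · exact Or.inr (Or.inl (hasRootType_of_isExtension he hr.form_self hes isExtension_A7_left))
  · exact Or.inr (Or.inr (Or.inl
      (hasRootType_of_isExtension he hr.form_self hes isExtension_D7_left)))
  · exact Or.inr (Or.inr (Or.inr
      (hasRootType_of_isExtension he hr.form_self hes isExtension_E7_left)))
  · exact Or.inr (Or.inr (Or.inr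
      (hasRootType_of_isExtension he hr.form_self hes isExtension_E7_right)))
  · exact Or.inr (Or.inr (Or.inl
      (hasRootType_of_isExtension he hr.form_self hes isExtension_D7_right)))
  · exact Or.inr (Or.inl (hasRootType_of_isExtension he hr.form_self hes isExtension_A7_right))

/-! ### Root lattices of rank seven and negative projections -/

/-- Minus the form is the sum of squared differences of consecutive coefficients along the path,
extended by zero at both ends. -/
lemma form_neg_of_mem_a6Span {v : V} (hv : v ∈ a6Span) (h : v ≠ 0) : form v v < 0 := by
  rw [a6Span, Submodule.mem_span_range_iff_exists_fun] at hv
  obtain ⟨c, rfl⟩ := hv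
  have hA : CartanMatrix.A 6 = !![2, -1, 0, 0, 0, 0; -1, 2, -1, 0, 0, 0; 0, -1, 2, -1, 0, 0;
      0, 0, -1, 2, -1, 0; 0, 0, 0, -1, 2, -1; 0, 0, 0, 0, -1, 2] := by decide
  have hf : form (∑ j, c j • a6Root j) (∑ j, c j • a6Root j) = -(c 0 ^ 2 + (c 0 - c 1) ^ 2 +
      (c 1 - c 2) ^ 2 + (c 2 - c 3) ^ 2 + (c 3 - c 4) ^ 2 + (c 4 - c 5) ^ 2 + c 5 ^ 2) := by
    simp only [map_sum, map_smul, LinearMap.sum_apply, LinearMap.smul_apply, form_a6Root, hA,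
      smul_eq_mul]
    simp [Fin.sum_univ_six]
    ring
  rw [hf]
  by_contra hle
  have hz : c 0 ^ 2 + (c 0 - c 1) ^ 2 + (c 1 - c 2) ^ 2 + (c 2 - c 3) ^ 2 + (c 3 - c 4) ^ 2 +
      (c 4 - c 5) ^ 2 + c 5 ^ 2 = 0 := le_antisymm (by linarith) (by positivity)
  have h0 := sq_nonneg (c 0)
  have h1 := sq_nonneg (c 0 - c 1)
  have h2 := sq_nonneg (c 1 - c 2)
  have h3 := sq_nonneg (c 2 - c 3)
  have h4 := sq_nonneg (c 3 - c 4)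
  have h5 := sq_nonneg (c 4 - c 5)
  have h6 := sq_nonneg (c 5)
  have e0 : c 0 = 0 := pow_eq_zero_iff two_ne_zero |>.1 (by linarith)
  have e1 : c 0 - c 1 = 0 := pow_eq_zero_iff two_ne_zero |>.1 (by linarith)
  have e2 : c 1 - c 2 = 0 := pow_eq_zero_iff two_ne_zero |>.1 (by linarith)
  have e3 : c 2 - c 3 = 0 := pow_eq_zero_iff two_ne_zero |>.1 (by linarith)
  have e4 : c 3 - c 4 = 0 := pow_eq_zero_iff two_ne_zero |>.1 (by linarith)
  have e5 : c 4 - c 5 = 0 := pow_eq_zero_iff two_ne_zero |>.1 (by linarith)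
  refine h (Finset.sum_eq_zero fun j _ => ?_)
  have : c j = 0 := by
    fin_cases j <;> simp only [Fin.zero_eta, Fin.mk_one, Fin.reduceFinMk] <;> linarith
  rw [this, zero_smul]

/-- `7r'` lies in the lattice, and it is not zero because its coefficient at `r` is 7 and the seven
generators are independent. -/
lemma form_proj_neg_of_isRootLattice {r : V} (hr : IsLeechRoot r) (hR : IsRootLattice (withA6 r))
    (hrank : Module.finrank ℤ (withA6 r) = 7) : form (proj r) (proj r) < 0 := by
  obtain ⟨e, he⟩ := hr.exists_hasPairing_int
  have hsum : (7 : ℝ) • proj r =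
      ∑ i, (Sum.elim (fun j => ∑ k, adjA6 j k * e k) (fun _ => 7) : Fin 6 ⊕ Fin 1 → ℤ) i •
        extFamily r i := by
    rw [seven_smul_proj he, Fintype.sum_sum_type, add_comm]
    simp only [← Int.cast_smul_eq_zsmul ℝ, extFamily, Sum.elim_inl, Sum.elim_inr,
      Finset.univ_unique, Finset.sum_singleton]
    norm_num
  have hmem : (7 : ℝ) • proj r ∈ withA6 r := by
    rw [withA6_eq, Submodule.mem_span_range_iff_exists_fun]
    exact ⟨_, hsum.symm⟩
  have hne : (7 : ℝ) • proj r ≠ 0 := by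
    intro h0
    rw [hsum] at h0
    have := Fintype.linearIndependent_iff.1 (linearIndependent_of_finrank hrank) _ h0 (Sum.inr 0)
    simp at this
  have := hR.negDef _ hmem hne
  simp only [map_smul, LinearMap.smul_apply, smul_eq_mul] at this
  linarith

lemma isRootLattice_of_form_proj_neg {r : V} (hr : IsLeechRoot r)
    (h : form (proj r) (proj r) < 0) :
    IsRootLattice (withA6 r) ∧ Module.finrank ℤ (withA6 r) = 7 := by
  obtain ⟨e, hes, he⟩ := exists_pairing_of_form_proj_neg hr h
  have hli := linearIndependent_extFamily he hr.form_self (dualNorm_lt_of_mem hes).ne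
  refine ⟨⟨?_, ?_, ?_⟩, ?_⟩
  · intro v hv w hw
    rw [withA6_eq, Submodule.mem_span_range_iff_exists_fun] at hv hw
    obtain ⟨c, rfl⟩ := hv
    obtain ⟨d, rfl⟩ := hw
    refine ⟨∑ j, d j * ∑ i, c i * -extCartan e i j, ?_⟩
    simp only [← Int.cast_smul_eq_zsmul ℝ, map_sum, map_smul, LinearMap.sum_apply,
      LinearMap.smul_apply, form_extFamily he hr.form_self, smul_eq_mul]
    push_cast
    rfl
  · intro v hv hv0
    obtain ⟨k, z, hz, rfl⟩ := Submodule.mem_span_insert.1 hv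
    have hz' : z ∈ a6Span := by
      have hle : Submodule.span ℤ (Set.range a6Root) ≤ a6Span.restrictScalars ℤ :=
        Submodule.span_le.2 Submodule.subset_span
      exact hle hz
    have hu : (k : ℝ) • (r - proj r) + z ∈ a6Span :=
      a6Span.add_mem (a6Span.smul_mem _ (sub_proj_mem r)) hz'
    -- The orthogonal splitting into a multiple of `r'` and a vector in the span of the diagram;
    -- both summands have nonpositive norm.
    have hv' : k • r + z = (k : ℝ) • proj r + ((k : ℝ) • (r - proj r) + z) := by
      rw [← Int.cast_smul_eq_zsmul ℝ, smul_sub]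
      abel
    have hf : form (k • r + z) (k • r + z) = (k : ℝ) ^ 2 * form (proj r) (proj r) +
        form ((k : ℝ) • (r - proj r) + z) ((k : ℝ) • (r - proj r) + z) := by
      have h1 := form_of_mem_a6Perp (proj_mem r) hu
      rw [hv']
      generalize (k : ℝ) • (r - proj r) + z = u at *
      simp only [map_add, map_smul, LinearMap.add_apply, LinearMap.smul_apply, smul_eq_mul, h1,
        form_comm u (proj r)]
      ring
    rw [hf]
    by_cases hk : k = 0
    · subst hk
      simp only [zero_smul, zero_add, Int.cast_zero] at hv0 ⊢
      have := form_neg_of_mem_a6Span hz' hv0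
      linarith
    · have h1 : 0 < (k : ℝ) ^ 2 := by positivity
      have h2 : form ((k : ℝ) • (r - proj r) + z) ((k : ℝ) • (r - proj r) + z) ≤ 0 := by
        by_cases h0 : (k : ℝ) • (r - proj r) + z = 0
        · rw [h0]
          simp
        · exact (form_neg_of_mem_a6Span hu h0).le
      nlinarith
  · refine le_antisymm (Submodule.span_le.2 fun v hv => hv.1) (Submodule.span_mono ?_)
    intro v hv
    refine ⟨Submodule.subset_span hv, ?_⟩
    rcases hv with rfl | ⟨j, rfl⟩
    · exact hr.form_self
    · exact (isLeechRoot_a6Root j).form_self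
  · rw [withA6_eq, finrank_span_eq_card hli]
    rfl

/-! ### The positive cone -/

lemma form_weylVector_right (x : V) : form x weylVector = x.2.1 := by
  simp [form_apply, weylVector]

lemma form_weylVector_self : form weylVector weylVector = 0 := by
  simp [form_apply, weylVector]

lemma smul_mem_positiveCone {x : V} (hx : x ∈ positiveCone) {t : ℝ} (ht : 0 < t) :
    t • x ∈ positiveCone := by
  obtain ⟨h1, h2⟩ := hx
  refine ⟨?_, ?_⟩ <;> simp only [map_smul, LinearMap.smul_apply, smul_eq_mul] <;> positivity

/-- The reversed Cauchy–Schwarz inequality: two vectors of one component of the cone pair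
positively. -/
lemma form_pos_of_mem_positiveCone {x y : V} (hx : x ∈ positiveCone) (hy : y ∈ positiveCone) :
    0 < form x y := by
  obtain ⟨hx1, hx2⟩ := hx
  obtain ⟨hy1, hy2⟩ := hy
  rw [form_weylVector_right] at hx2 hy2
  rw [form_apply] at hx1 hy1 ⊢
  have h : 0 ≤ ∑ i, (y.2.1 * x.2.2 i - x.2.1 * y.2.2 i) ^ 2 :=
    Finset.sum_nonneg fun i _ => sq_nonneg _
  have h' : ∑ i, (y.2.1 * x.2.2 i - x.2.1 * y.2.2 i) ^ 2 =
      y.2.1 ^ 2 * ∑ i, x.2.2 i * x.2.2 i + x.2.1 ^ 2 * ∑ i, y.2.2 i * y.2.2 i -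
        2 * (x.2.1 * y.2.1) * ∑ i, x.2.2 i * y.2.2 i := by
    simp only [Finset.mul_sum, ← Finset.sum_add_distrib, ← Finset.sum_sub_distrib]
    exact Finset.sum_congr rfl fun i _ => by ring
  rw [h'] at h
  generalize ∑ i, x.2.2 i * x.2.2 i = a at *
  generalize ∑ i, y.2.2 i * y.2.2 i = b at *
  generalize ∑ i, x.2.2 i * y.2.2 i = c at *
  generalize x.1 = m at *
  generalize x.2.1 = n at *
  generalize y.1 = m' at *
  generalize y.2.1 = n' at *
  have h1 : 0 < n' ^ 2 * (16 * (m * n) - a) := mul_pos (by positivity) (by linarith)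
  have h2 : 0 < n ^ 2 * (16 * (m' * n') - b) := mul_pos (by positivity) (by linarith)
  -- This quantity is the sum of those in `h1` and `h2` and of the sum of squares in `h`.
  have h3 : 0 < 2 * (n * n') * (8 * (m * n' + n * m') - c) := by nlinarith
  have h4 : 0 < 8 * (m * n' + n * m') - c := pos_of_mul_pos_right h3 (by positivity)
  linarith

lemma add_mem_positiveCone {x y : V} (hx : x ∈ positiveCone) (hy : y ∈ positiveCone) :
    x + y ∈ positiveCone := by
  have h := form_pos_of_mem_positiveCone hx hy
  obtain ⟨hx1, hx2⟩ := hx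
  obtain ⟨hy1, hy2⟩ := hy
  refine ⟨?_, ?_⟩
  · simp only [map_add, LinearMap.add_apply, form_comm y x]
    linarith
  · simp only [map_add, LinearMap.add_apply]
    linarith

/-- The signature is `(1,25)`. Subtracting a multiple of `x` moves `v` into the hyperplane
orthogonal to the Weyl vector, where the form is negative semidefinite, while orthogonality shows
that the norm does not decrease. -/
lemma form_neg_of_orthogonal {x v : V} (hx : x ∈ positiveCone) (h : form x v = 0) (hv : v ≠ 0) :
    form v v < 0 := by
  obtain ⟨hx1, hx2⟩ := hx
  rw [form_weylVector_right] at hx2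
  have hn := hx2.ne'
  obtain ⟨u, hu⟩ : ∃ u, u = v - (v.2.1 / x.2.1) • x := ⟨_, rfl⟩
  have hu0 : u.2.1 = 0 := by
    rw [hu]
    simp [hn]
  have huu : form u u = form v v + (v.2.1 / x.2.1) ^ 2 * form x x := by
    rw [hu]
    simp only [map_sub, map_smul, LinearMap.sub_apply, LinearMap.smul_apply, smul_eq_mul, h,
      form_comm v x]
    ring
  have hsq : 0 ≤ ∑ i, u.2.2 i * u.2.2 i := Finset.sum_nonneg fun i _ => mul_self_nonneg _
  have huu' : form u u = -(∑ i, u.2.2 i * u.2.2 i) / 8 := by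
    rw [form_apply, hu0]
    ring
  have hterm : 0 ≤ (v.2.1 / x.2.1) ^ 2 * form x x := by positivity
  by_contra hle
  have h1 : ∑ i, u.2.2 i * u.2.2 i = 0 := by linarith
  have h2 : (v.2.1 / x.2.1) ^ 2 * form x x = 0 := by linarith
  have h3 : v.2.1 = 0 := by
    rcases mul_eq_zero.1 h2 with h3 | h3
    · have := (pow_eq_zero_iff two_ne_zero).1 h3
      rcases div_eq_zero_iff.1 this with h | h
      · exact h
      · exact absurd h hn
    · exact absurd h3 hx1.ne'
  have huv : u = v := by
    rw [hu, h3]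
    simp
  rw [huv] at h1
  have h4 : ∀ i, v.2.2 i = 0 := fun i => mul_self_eq_zero.1 <|
    (Finset.sum_eq_zero_iff_of_nonneg fun i _ => mul_self_nonneg _).1 h1 i (Finset.mem_univ i)
  have h5 : v.1 = 0 := by
    rw [form_apply, h3] at h
    simp only [h4, mul_zero, Finset.sum_const_zero, zero_div, zero_add, sub_zero] at h
    exact (mul_eq_zero.1 h).resolve_left hn
  exact hv (Prod.ext h5 (Prod.ext h3 (funext h4)))

/-! ### Local finiteness of the walls -/

lemma form_leechRoot_right (x : V) (ξ : Omega → ℤ) :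
    form x (leechRoot ξ) = x.1 + x.2.1 * ((∑ i, (ξ i : ℝ) ^ 2) / 16 - 1) -
      (∑ i, x.2.2 i * ξ i) / 8 := by
  simp only [form_apply, leechRoot, toReal, mul_one]

lemma le_form_leechRoot {x : V} (hx : 0 < x.2.1) (ξ : Omega → ℤ) :
    x.2.1 / 32 * ∑ i, (ξ i : ℝ) ^ 2 - (x.2.1 - x.1 + (∑ i, x.2.2 i ^ 2) / (8 * x.2.1)) ≤
      form x (leechRoot ξ) := by
  -- Completing the square with weight `1/4` costs half of the leading coefficient `1/16`, so
  -- quadratic growth in `ξ` survives.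
  have h : ∑ i, x.2.2 i * ξ i ≤
      x.2.1 / 4 * ∑ i, (ξ i : ℝ) ^ 2 + (∑ i, x.2.2 i ^ 2) / x.2.1 := by
    rw [Finset.mul_sum, Finset.sum_div, ← Finset.sum_add_distrib]
    refine Finset.sum_le_sum fun i _ => ?_
    have h1 : x.2.1 / 4 * (ξ i : ℝ) ^ 2 + x.2.2 i ^ 2 / x.2.1 - x.2.2 i * ξ i =
        (x.2.1 * ξ i / 2 - x.2.2 i) ^ 2 / x.2.1 := by
      field_simp
      ring
    have h2 : 0 ≤ (x.2.1 * ξ i / 2 - x.2.2 i) ^ 2 / x.2.1 := by positivity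
    linarith
  have h' : (∑ i, x.2.2 i ^ 2) / (8 * x.2.1) = (∑ i, x.2.2 i ^ 2) / x.2.1 / 8 := by
    rw [mul_comm, div_div]
  rw [form_leechRoot_right, h']
  linarith

lemma abs_form_leechRoot_le (v : V) (ξ : Omega → ℤ) :
    |form v (leechRoot ξ)| ≤ (|v.1| + |v.2.1| + ∑ i, v.2.2 i ^ 2 + 1) *
      (∑ i, (ξ i : ℝ) ^ 2 + 1) := by
  have h : |∑ i, v.2.2 i * ξ i| ≤ ∑ i, v.2.2 i ^ 2 + ∑ i, (ξ i : ℝ) ^ 2 := by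
    refine (Finset.abs_sum_le_sum_abs _ _).trans ?_
    rw [← Finset.sum_add_distrib]
    refine Finset.sum_le_sum fun i _ => abs_le.2 ⟨?_, ?_⟩
    · nlinarith [sq_nonneg (v.2.2 i + ξ i), sq_nonneg (v.2.2 i), sq_nonneg (ξ i : ℝ)]
    · nlinarith [sq_nonneg (v.2.2 i - ξ i), sq_nonneg (v.2.2 i), sq_nonneg (ξ i : ℝ)]
  have hq : 0 ≤ ∑ i, (ξ i : ℝ) ^ 2 := Finset.sum_nonneg fun i _ => sq_nonneg _
  have hv : 0 ≤ ∑ i, v.2.2 i ^ 2 := Finset.sum_nonneg fun i _ => sq_nonneg _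
  rw [form_leechRoot_right]
  generalize ∑ i, v.2.2 i * ξ i = p at *
  generalize ∑ i, (ξ i : ℝ) ^ 2 = q at *
  generalize ∑ i, v.2.2 i ^ 2 = c at *
  have h1 : |v.2.1 * (q / 16 - 1)| ≤ |v.2.1| * (q + 1) := by
    rw [abs_mul]
    refine mul_le_mul_of_nonneg_left (abs_le.2 ⟨by linarith, by linarith⟩) (abs_nonneg _)
  have h2 : |v.1 + v.2.1 * (q / 16 - 1) - p / 8| ≤
      |v.1| + |v.2.1 * (q / 16 - 1)| + |p| / 8 := by
    have e1 := abs_sub (v.1 + v.2.1 * (q / 16 - 1)) (p / 8)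
    have e2 := abs_add_le v.1 (v.2.1 * (q / 16 - 1))
    rw [abs_div, abs_of_pos (by norm_num : (0 : ℝ) < 8)] at e1
    linarith
  nlinarith [abs_nonneg v.1, abs_nonneg v.2.1, mul_nonneg (abs_nonneg v.1) hq, mul_nonneg hv hq]

lemma finite_setOf_sum_sq_le (Q : ℝ) : {ξ : Omega → ℤ | ∑ i, (ξ i : ℝ) ^ 2 ≤ Q}.Finite := by
  obtain ⟨N, hN⟩ := exists_nat_ge Q
  refine (Set.Finite.pi' fun _ => Set.finite_Icc (-(N : ℤ)) N).subset fun ξ hξ i => ?_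
  have h1 : (ξ i : ℝ) ^ 2 ≤ N := by
    refine le_trans ?_ (le_trans hξ hN)
    exact Finset.single_le_sum (f := fun i => (ξ i : ℝ) ^ 2) (fun i _ => sq_nonneg _)
      (Finset.mem_univ i)
  have h2 : ξ i ^ 2 ≤ (N : ℤ) := by exact_mod_cast h1
  constructor <;> nlinarith

/-- Infinitely many strict inequalities at a point persist for small displacements: inside the cone
the pairing with a Leech root grows quadratically in `ξ`, so only finitely many roots need
individual care. -/
lemma eventually_forall_form_pos {x : V} (hx : 0 < x.2.1) (v : V) (S : Set (Omega → ℤ))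
    (hS : ∀ ξ ∈ S, 0 < form x (leechRoot ξ)) :
    ∀ᶠ s in 𝓝 (0 : ℝ), ∀ ξ ∈ S, 0 < form (x + s • v) (leechRoot ξ) := by
  obtain ⟨ε, hε, B, hB⟩ : ∃ ε : ℝ, 0 < ε ∧ ∃ B : ℝ, ∀ ξ : Omega → ℤ,
      ε * ∑ i, (ξ i : ℝ) ^ 2 - B ≤ form x (leechRoot ξ) :=
    ⟨x.2.1 / 32, by positivity, _, le_form_leechRoot hx⟩
  obtain ⟨C, hC⟩ : ∃ C : ℝ, ∀ ξ : Omega → ℤ,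
      |form v (leechRoot ξ)| ≤ C * (∑ i, (ξ i : ℝ) ^ 2 + 1) := ⟨_, abs_form_leechRoot_le v⟩
  have hf : ∀ (s : ℝ) (ξ : Omega → ℤ), form (x + s • v) (leechRoot ξ) =
      form x (leechRoot ξ) + s * form v (leechRoot ξ) := fun s ξ => by simp
  -- Write `q = ∑ ξᵢ²`. Beyond this threshold `εq - B` exceeds `(ε/2)(q + 1)`, which bounds the
  -- perturbation.
  have hfin : ∀ᶠ s in 𝓝 (0 : ℝ), ∀ ξ ∈ {ξ : Omega → ℤ | ∑ i, (ξ i : ℝ) ^ 2 ≤ 2 * B / ε + 1},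
      ξ ∈ S → 0 < form (x + s • v) (leechRoot ξ) := by
    rw [eventually_all_finite (finite_setOf_sum_sq_le _)]
    intro ξ _
    by_cases hξ : ξ ∈ S
    · have hc : Continuous fun s : ℝ => form x (leechRoot ξ) + s * form v (leechRoot ξ) := by
        fun_prop
      have h0 : ∀ᶠ s in 𝓝 (0 : ℝ), 0 < form x (leechRoot ξ) + s * form v (leechRoot ξ) :=
        hc.continuousAt.eventually (lt_mem_nhds (by simpa using hS ξ hξ))
      filter_upwards [h0] with s hs _
      rwa [hf]
    · exact Eventually.of_forall fun s h => absurd h hξ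
  have hsmall : ∀ᶠ s in 𝓝 (0 : ℝ), |s| * C < ε / 2 := by
    have hc : Continuous fun s : ℝ => |s| * C := by fun_prop
    exact hc.continuousAt.eventually (gt_mem_nhds (by simpa using hε))
  filter_upwards [hfin, hsmall] with s h1 h2 ξ hξ
  by_cases hq : ∑ i, (ξ i : ℝ) ^ 2 ≤ 2 * B / ε + 1
  · exact h1 ξ hq hξ
  · rw [hf]
    push Not at hq
    have h3 := hB ξ
    have h4 := hC ξ
    have h5 : |s * form v (leechRoot ξ)| ≤ ε / 2 * (∑ i, (ξ i : ℝ) ^ 2 + 1) := by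
      rw [abs_mul]
      have hq0 : 0 ≤ ∑ i, (ξ i : ℝ) ^ 2 + 1 :=
        add_nonneg (Finset.sum_nonneg fun i _ => sq_nonneg _) zero_le_one
      calc |s| * |form v (leechRoot ξ)| ≤ |s| * (C * (∑ i, (ξ i : ℝ) ^ 2 + 1)) :=
            mul_le_mul_of_nonneg_left h4 (abs_nonneg s)
        _ = |s| * C * (∑ i, (ξ i : ℝ) ^ 2 + 1) := by ring
        _ ≤ _ := mul_le_mul_of_nonneg_right h2.le hq0
    have h6 := (abs_le.1 h5).1
    have h7 : 2 * B + ε < ε * ∑ i, (ξ i : ℝ) ^ 2 := by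
      have := mul_lt_mul_of_pos_left hq hε
      have e : ε * (2 * B / ε + 1) = 2 * B + ε := by field_simp
      linarith
    linarith

lemma eventually_mem_positiveCone {x : V} (hx : x ∈ positiveCone) (v : V) :
    ∀ᶠ s in 𝓝 (0 : ℝ), x + s • v ∈ positiveCone := by
  have hf : ∀ s : ℝ, form (x + s • v) (x + s • v) =
      form x x + s * (2 * form x v) + s ^ 2 * form v v := fun s => by
    simp only [map_add, map_smul, LinearMap.add_apply, LinearMap.smul_apply, smul_eq_mul,
      form_comm v x]
    ring
  have hg : ∀ s : ℝ, form (x + s • v) weylVector = form x weylVector + s * form v weylVector :=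
    fun s => by simp
  have h1 : Continuous fun s : ℝ => form x x + s * (2 * form x v) + s ^ 2 * form v v := by fun_prop
  have h2 : Continuous fun s : ℝ => form x weylVector + s * form v weylVector := by fun_prop
  have e1 : ∀ᶠ s in 𝓝 (0 : ℝ), 0 < form x x + s * (2 * form x v) + s ^ 2 * form v v :=
    h1.continuousAt.eventually (lt_mem_nhds (by simpa using hx.1))
  have e2 : ∀ᶠ s in 𝓝 (0 : ℝ), 0 < form x weylVector + s * form v weylVector :=
    h2.continuousAt.eventually (lt_mem_nhds (by simpa using hx.2))
  filter_upwards [e1, e2] with s h3 h4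
  exact ⟨by rwa [hf], by rwa [hg]⟩

/-! ### The restricted domain -/

lemma continuous_form_left (r : V) : Continuous fun x : V => form x r :=
  (form.flip r).continuous_of_finiteDimensional

lemma mem_Dprime_iff (x : V) :
    x ∈ Dprime ↔ x ∈ positiveCone ∧ x ∈ a6Perp ∧ ∀ r, IsLeechRoot r → 0 ≤ form x r := by
  constructor
  · rintro ⟨⟨hx, hc⟩, hp⟩
    refine ⟨hx, hp, fun r hr => ?_⟩
    have hcl : IsClosed {x : V | 0 ≤ form x r} :=
      isClosed_le continuous_const (continuous_form_left r)
    exact closure_minimal (fun y hy => (hy.2 r hr).le) hcl hc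
  · rintro ⟨hx, hp, hr⟩
    refine ⟨⟨hx, ?_⟩, hp⟩
    obtain ⟨d, hd⟩ : ∃ d : V, ∀ r, IsLeechRoot r → 0 < form d r := by
      -- This vector pairs to `1 + (∑ ξᵢ²)/16` with a Leech root; moving towards it from a point of
      -- the closed domain enters the open one.
      refine ⟨(2, 1, 0), fun r hr => ?_⟩
      obtain ⟨ξ, -, rfl⟩ := hr.2
      have : 0 ≤ ∑ i, (ξ i : ℝ) ^ 2 := Finset.sum_nonneg fun i _ => sq_nonneg _
      rw [form_leechRoot_right]
      simp only [Pi.zero_apply, zero_mul, Finset.sum_const_zero]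
      linarith
    have ht : Tendsto (fun s : ℝ => x + s • d) (𝓝[>] 0) (𝓝 x) := by
      have hc : Continuous fun s : ℝ => x + s • d := by fun_prop
      have := hc.tendsto 0
      rw [zero_smul, add_zero] at this
      exact this.mono_left nhdsWithin_le_nhds
    refine mem_closure_of_tendsto ht ?_
    filter_upwards [nhdsWithin_le_nhds (eventually_mem_positiveCone hx d), self_mem_nhdsWithin]
      with s hs hs0
    refine ⟨hs, fun r hr' => ?_⟩
    have h1 := hr r hr'
    have h2 := mul_pos (Set.mem_Ioi.1 hs0) (hd r hr')
    simp only [map_add, map_smul, LinearMap.add_apply, LinearMap.smul_apply, smul_eq_mul]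
    linarith

lemma eventually_mem_Dprime {x v : V} (hx : x ∈ positiveCone) (hxp : x ∈ a6Perp)
    (hv : v ∈ a6Perp)
    (h : ∀ r, IsLeechRoot r → 0 < form x r ∨ form x r = 0 ∧ form v r = 0) :
    ∀ᶠ s in 𝓝 (0 : ℝ), x + s • v ∈ Dprime := by
  have hn : 0 < x.2.1 := by
    rw [← form_weylVector_right]
    exact hx.2
  filter_upwards [eventually_mem_positiveCone hx v, eventually_forall_form_pos hn v
    {ξ | 0 < form x (leechRoot ξ)} fun ξ hξ => hξ] with s h1 h2
  refine (mem_Dprime_iff _).2 ⟨h1, a6Perp.add_mem hxp (a6Perp.smul_mem _ hv), fun r hr => ?_⟩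
  obtain ⟨ξ, -, rfl⟩ := hr.2
  rcases h _ hr with h3 | ⟨h3, h4⟩
  · exact (h2 ξ h3).le
  · simp [h3, h4]

lemma mem_Dprime_of_pos {x : V} (hx : x ∈ positiveCone) (hxp : x ∈ a6Perp)
    (h : ∀ r, IsLeechRoot r → r ∉ Set.range a6Root → 0 ≤ form x r) : x ∈ Dprime := by
  refine (mem_Dprime_iff x).2 ⟨hx, hxp, fun r hr => ?_⟩
  by_cases h' : r ∈ Set.range a6Root
  · obtain ⟨j, rfl⟩ := h'
    exact ((mem_a6Perp_iff x).1 hxp j).ge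
  · exact h r hr h'

/-! ### The projected Weyl vector and the perpendiculars from it to the walls -/

lemma hasPairing_weylVector : HasPairing weylVector fun _ => 1 := fun j => by
  rw [(isLeechRoot_a6Root j).form_weylVector]
  norm_num

/-- The Weyl vector is isotropic and pairs to 1 with all simple roots, so its projection is `w + ρ`
with `ρ` the half sum of the positive roots of `A₆`; up to sign `ρ` has norm `6·7·8/12 = 28`. -/
lemma form_proj_weylVector_self : form (proj weylVector) (proj weylVector) = 28 := by
  have : dualNorm (fun _ => 1) = 196 := by decide +kernel
  rw [form_proj_self hasPairing_weylVector, form_weylVector_self, this]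
  norm_num

lemma one_le_form_proj_weylVector {r : V} (hr : IsLeechRoot r) (h : r ∉ Set.range a6Root) :
    1 ≤ form (proj weylVector) r := by
  obtain ⟨e, he⟩ := hr.exists_hasPairing h
  rw [form_proj_left hasPairing_weylVector he, hr.form_weylVector]
  have h2 : 0 ≤ ∑ j, (e j : ℤ) * ∑ k, adjA6 j k * 1 :=
    Finset.sum_nonneg fun j _ => mul_nonneg (by positivity) <| Finset.sum_nonneg fun k _ =>
      mul_nonneg (adjA6_pos j k).le (by positivity)
  have h3 : (0 : ℝ) ≤ ((∑ j, (e j : ℤ) * ∑ k, adjA6 j k * 1 : ℤ) : ℝ) := by exact_mod_cast h2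
  have : 0 ≤ ((∑ j, (e j : ℤ) * ∑ k, adjA6 j k * 1 : ℤ) : ℝ) / 7 := by positivity
  linarith

lemma proj_weylVector_mem : proj weylVector ∈ positiveCone := by
  refine ⟨?_, ?_⟩
  · rw [form_proj_weylVector_self]
    norm_num
  · rw [← form_proj_right (proj_mem _), form_proj_weylVector_self]
    norm_num

/-- A point in the relative interior of the face of `D'` cut out by `r`. -/
noncomputable def facePoint (r : V) : V :=
  proj weylVector + (form (proj weylVector) r / -form (proj r) (proj r)) • proj r

lemma facePoint_mem_a6Perp (r : V) : facePoint r ∈ a6Perp :=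
  a6Perp.add_mem (proj_mem _) (a6Perp.smul_mem _ (proj_mem _))

lemma form_facePoint {r : V} (h : form (proj r) (proj r) < 0) : form (facePoint r) r = 0 := by
  rw [← form_proj_right (facePoint_mem_a6Perp r), facePoint]
  simp only [map_add, map_smul, LinearMap.add_apply, LinearMap.smul_apply, smul_eq_mul]
  rw [form_proj_right (proj_mem weylVector)]
  have := h.ne
  field_simp
  ring

lemma facePoint_coeff_pos {r : V} (hr : IsLeechRoot r) (h : form (proj r) (proj r) < 0) :
    0 < form (proj weylVector) r / -form (proj r) (proj r) := by
  have := one_le_form_proj_weylVector hr (not_mem_range_of_form_proj_neg h)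
  exact div_pos (by linarith) (by linarith)

/-- The point is `w'` plus a positive multiple of `r'`; the first summand pairs to at least 1 with
`s`, the second to at least 0. -/
lemma form_facePoint_pos {r : V} (hr : IsLeechRoot r) (h : form (proj r) (proj r) < 0)
    {s : V} (hs : IsLeechRoot s) (hs' : s ∉ Set.range a6Root) (hne : s ≠ r) :
    0 < form (facePoint r) s := by
  have h1 := one_le_form_proj_weylVector hs hs'
  have h2 := form_proj_nonneg hr hs hne.symm (not_mem_range_of_form_proj_neg h) hs'
  have h3 := mul_nonneg (facePoint_coeff_pos hr h).le h2
  rw [facePoint]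
  simp only [map_add, map_smul, LinearMap.add_apply, LinearMap.smul_apply, smul_eq_mul]
  linarith

/-- As the point is orthogonal to `r`, its norm equals its inner product with `w'`, which is at
least 28. -/
lemma facePoint_mem_positiveCone {r : V} (hr : IsLeechRoot r) (h : form (proj r) (proj r) < 0) :
    facePoint r ∈ positiveCone := by
  have hr' := not_mem_range_of_form_proj_neg h
  have hw : form (proj r) (proj weylVector) = form (proj weylVector) r := by
    rw [form_comm, form_proj_right (proj_mem _)]
  have h1 := one_le_form_proj_weylVector hr hr'
  have hc := facePoint_coeff_pos hr h
  have h2 : 0 < form (facePoint r) (proj weylVector) := by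
    rw [facePoint]
    simp only [map_add, map_smul, LinearMap.add_apply, LinearMap.smul_apply, smul_eq_mul]
    rw [hw, form_proj_weylVector_self]
    have := mul_nonneg hc.le (by linarith : 0 ≤ form (proj weylVector) r)
    linarith
  refine ⟨?_, ?_⟩
  · have h3 : form (facePoint r) (facePoint r) = form (facePoint r) (proj weylVector) := by
      conv_lhs => enter [2]; rw [facePoint]
      rw [map_add, map_smul, form_proj_right (facePoint_mem_a6Perp r) r, form_facePoint h,
        smul_zero, add_zero]
    rwa [h3]
  · rwa [← form_proj_right (facePoint_mem_a6Perp r)]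

lemma facePoint_pos_or {r : V} (hr : IsLeechRoot r) (h : form (proj r) (proj r) < 0)
    {s v : V} (hs : IsLeechRoot s) (hv : v ∈ a6Perp) (hvr : form v r = 0) :
    0 < form (facePoint r) s ∨ form (facePoint r) s = 0 ∧ form v s = 0 := by
  by_cases hs' : s ∈ Set.range a6Root
  · obtain ⟨j, rfl⟩ := hs'
    exact Or.inr ⟨(mem_a6Perp_iff _).1 (facePoint_mem_a6Perp r) j, (mem_a6Perp_iff _).1 hv j⟩
  · by_cases hsr : s = r
    · subst hsr
      exact Or.inr ⟨form_facePoint h, hvr⟩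
    · exact Or.inl (form_facePoint_pos hr h hs hs' hsr)

lemma facePoint_mem_Dprime {r : V} (hr : IsLeechRoot r) (h : form (proj r) (proj r) < 0) :
    facePoint r ∈ Dprime := by
  refine (mem_Dprime_iff _).2 ⟨facePoint_mem_positiveCone hr h, facePoint_mem_a6Perp r,
    fun s hs => ?_⟩
  rcases facePoint_pos_or hr h hs (facePoint_mem_a6Perp r) (form_facePoint h) with h1 | h1
  · exact h1.le
  · exact h1.1.ge

/-! ### The faces of the restricted domain -/

/-- A set that contains a neighbourhood of one of its points along every line in a subspace spans
that subspace. -/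
lemma span_eq_of_eventually {F : Set V} {H : Submodule ℝ V} {x : V} (hF : F ⊆ H) (hx : x ∈ F)
    (h : ∀ v ∈ H, ∀ᶠ s in 𝓝 (0 : ℝ), x + s • v ∈ F) : Submodule.span ℝ F = H := by
  refine le_antisymm (Submodule.span_le.2 hF) fun v hv => ?_
  have hev : ∀ᶠ s in 𝓝[≠] (0 : ℝ), x + s • v ∈ F := nhdsWithin_le_nhds (h v hv)
  obtain ⟨s, hs, hs0⟩ := (hev.and self_mem_nhdsWithin).exists
  have h1 : s • v ∈ Submodule.span ℝ F := by
    have := (Submodule.span ℝ F).sub_mem (Submodule.subset_span hs) (Submodule.subset_span hx)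
    rwa [add_sub_cancel_left] at this
  rw [← inv_smul_smul₀ (a := s) hs0 v]
  exact Submodule.smul_mem _ _ h1

lemma span_Dprime : Submodule.span ℝ Dprime = a6Perp := by
  refine span_eq_of_eventually (x := proj weylVector) (fun x hx => hx.2)
    (mem_Dprime_of_pos proj_weylVector_mem (proj_mem _) fun r hr h =>
      zero_le_one.trans (one_le_form_proj_weylVector hr h)) fun v hv =>
    eventually_mem_Dprime proj_weylVector_mem (proj_mem _) hv fun r hr => ?_
  by_cases h : r ∈ Set.range a6Root
  · obtain ⟨j, rfl⟩ := h
    exact Or.inr ⟨(mem_a6Perp_iff _).1 (proj_mem _) j, (mem_a6Perp_iff _).1 hv j⟩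
  · exact Or.inl (zero_lt_one.trans_le (one_le_form_proj_weylVector hr h))

/-- The part of `D'` orthogonal to the projection of `r`. -/
def wallFace (r : V) : Set V := {x | x ∈ Dprime ∧ form x (proj r) = 0}

/-- The hyperplane of the complement of `A₆` orthogonal to the projection of `r`. -/
noncomputable def wallSpan (r : V) : Submodule ℝ V :=
  a6Perp ⊓ LinearMap.ker (form.flip (proj r))

lemma mem_wallSpan_iff (r x : V) : x ∈ wallSpan r ↔ x ∈ a6Perp ∧ form x (proj r) = 0 := Iff.rfl

lemma finrank_wallSpan {r : V} (h : form (proj r) (proj r) ≠ 0) :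
    Module.finrank ℝ (wallSpan r) + 1 = Module.finrank ℝ a6Perp := by
  have hne : (form.flip (proj r)).domRestrict a6Perp ≠ 0 := fun h0 =>
    h (LinearMap.congr_fun h0 ⟨proj r, proj_mem r⟩)
  rw [← Module.Dual.finrank_ker_add_one_of_ne_zero hne, wallSpan]
  have : a6Perp ⊓ LinearMap.ker (form.flip (proj r)) =
      (LinearMap.ker ((form.flip (proj r)).domRestrict a6Perp)).map a6Perp.subtype := by
    ext x
    simp only [Submodule.mem_inf, LinearMap.mem_ker, Submodule.mem_map, Submodule.subtype_apply,
      LinearMap.domRestrict_apply]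
    exact ⟨fun ⟨h1, h2⟩ => ⟨⟨x, h1⟩, h2, rfl⟩, by rintro ⟨y, hy, rfl⟩; exact ⟨y.2, hy⟩⟩
  rw [this, Submodule.finrank_map_subtype_eq]

lemma wallFace_subset (r : V) : wallFace r ⊆ wallSpan r := fun _ hx => ⟨hx.1.2, hx.2⟩

lemma facePoint_mem_wallFace {r : V} (hr : IsLeechRoot r) (h : form (proj r) (proj r) < 0) :
    facePoint r ∈ wallFace r :=
  ⟨facePoint_mem_Dprime hr h, by
    rw [form_proj_right (facePoint_mem_a6Perp r), form_facePoint h]⟩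

lemma span_wallFace {r : V} (hr : IsLeechRoot r) (h : form (proj r) (proj r) < 0) :
    Submodule.span ℝ (wallFace r) = wallSpan r := by
  refine span_eq_of_eventually (wallFace_subset r) (facePoint_mem_wallFace hr h) fun v hv => ?_
  have hvr : form v r = 0 := by rw [← form_proj_right hv.1, ← (mem_wallSpan_iff r v).1 hv |>.2]
  filter_upwards [eventually_mem_Dprime (facePoint_mem_positiveCone hr h)
    (facePoint_mem_a6Perp r) hv.1 fun s hs => facePoint_pos_or hr h hs hv.1 hvr] with s hs
  refine ⟨hs, ?_⟩
  have h1 := (facePoint_mem_wallFace hr h).2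
  have h2 : form v (proj r) = 0 := hv.2
  simp [h1, h2]

lemma wallFace_mem_faces {r : V} (hr : IsLeechRoot r) (h : form (proj r) (proj r) < 0) :
    wallFace r ∈ faces Dprime := by
  -- Exposed faces are sets of maxima, whereas the pairing with `r'` is minimal on the wall; hence
  -- the sign.
  refine ⟨fun _ => ⟨-LinearMap.toContinuousLinearMap (form.flip (proj r)), ?_⟩, ?_⟩
  · have hnonneg : ∀ y ∈ Dprime, 0 ≤ form y (proj r) := fun y hy => by
      rw [form_proj_right hy.2]
      exact ((mem_Dprime_iff y).1 hy).2.2 r hr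
    ext x
    refine and_congr_right fun hx => ?_
    change form x (proj r) = 0 ↔ ∀ y ∈ Dprime, -form y (proj r) ≤ -form x (proj r)
    constructor
    · intro h0 y hy
      rw [h0, neg_zero]
      linarith [hnonneg y hy]
    · intro hle
      have h1 := hle _ (facePoint_mem_Dprime hr h)
      rw [(facePoint_mem_wallFace hr h).2] at h1
      linarith [hnonneg x hx]
  · rw [span_wallFace hr h, span_Dprime, finrank_wallSpan h.ne]

lemma wallFace_injective {r s : V} (hr : IsLeechRoot r) (h : form (proj r) (proj r) < 0)
    (hs : IsLeechRoot s) (h' : form (proj s) (proj s) < 0) (heq : wallFace r = wallFace s) :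
    r = s := by
  by_contra hne
  have h1 := facePoint_mem_wallFace hr h
  rw [heq] at h1
  have h2 := h1.2
  rw [form_proj_right (facePoint_mem_a6Perp r)] at h2
  exact (form_facePoint_pos hr h hs (not_mem_range_of_form_proj_neg h') (Ne.symm hne)).ne' h2

lemma smul_mem_Dprime {x : V} (hx : x ∈ Dprime) {t : ℝ} (ht : 0 < t) : t • x ∈ Dprime := by
  rw [mem_Dprime_iff] at hx ⊢
  refine ⟨smul_mem_positiveCone hx.1 ht, a6Perp.smul_mem _ hx.2.1, fun r hr => ?_⟩
  rw [map_smul, LinearMap.smul_apply, smul_eq_mul]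
  exact mul_nonneg ht.le (hx.2.2 r hr)

lemma add_mem_Dprime {x y : V} (hx : x ∈ Dprime) (hy : y ∈ Dprime) : x + y ∈ Dprime := by
  rw [mem_Dprime_iff] at hx hy ⊢
  refine ⟨add_mem_positiveCone hx.1 hy.1, a6Perp.add_mem hx.2.1 hy.2.1, fun r hr => ?_⟩
  rw [map_add, LinearMap.add_apply]
  exact add_nonneg (hx.2.2 r hr) (hy.2.2 r hr)

/-- A crude bound on the dimension 20, enough to keep the empty set from being a face. -/
lemma two_le_finrank_a6Perp : 2 ≤ Module.finrank ℝ a6Perp := by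
  have h1 := Submodule.finrank_add_eq_of_isCompl isCompl_a6
  have h2 : Module.finrank ℝ a6Span ≤ 6 := by
    have := finrank_range_le_card (R := ℝ) a6Root
    rwa [Set.finrank, Fintype.card_fin] at this
  have h3 : Module.finrank ℝ V = 26 := by
    have : Fintype.card Omega = 24 := by decide
    simp [Module.finrank_prod, this]
  omega

/-- An exposed face of a cone is the zero set of a functional that is nonpositive on the cone. -/
lemma exists_supporting_functional {F : Set V} (hF : IsExposed ℝ Dprime F) (hne : F.Nonempty) :
    ∃ l : V →ₗ[ℝ] ℝ, (∀ x ∈ Dprime, l x ≤ 0) ∧ F = {x | x ∈ Dprime ∧ l x = 0} := by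
  obtain ⟨l, hl⟩ := hF hne
  obtain ⟨x₀, hx₀⟩ := hne
  have hx₀' := hx₀
  rw [hl] at hx₀'
  obtain ⟨hxD, hmax⟩ := hx₀'
  have h0 : l x₀ = 0 := by
    -- On a cone the maximum of a linear functional can only be zero; scaling by 2 and by `1/2`
    -- gives the two inequalities.
    have h1 := hmax _ (smul_mem_Dprime hxD (t := 2) (by norm_num))
    have h2 := hmax _ (smul_mem_Dprime hxD (t := 1 / 2) (by norm_num))
    rw [map_smul, smul_eq_mul] at h1 h2
    linarith
  have hle : ∀ x ∈ Dprime, l x ≤ 0 := fun x hx => h0 ▸ hmax x hx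
  refine ⟨l, hle, ?_⟩
  rw [hl]
  ext x
  refine and_congr_right fun hx => ⟨fun h => ?_, fun h y hy => ?_⟩
  · exact le_antisymm (hle x hx) (h0 ▸ h x₀ hxD)
  · exact (hle y hy).trans_eq h.symm

lemma exists_wallFace_eq {F : Set V} (hF : F ∈ faces Dprime) :
    ∃ r, IsLeechRoot r ∧ form (proj r) (proj r) < 0 ∧ wallFace r = F := by
  obtain ⟨hexp, hrank⟩ := hF
  rw [span_Dprime] at hrank
  -- The empty set is vacuously exposed and has to be excluded by dimension.
  have hne : F.Nonempty := by
    rw [Set.nonempty_iff_ne_empty]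
    rintro rfl
    rw [Submodule.span_empty, finrank_bot] at hrank
    have := two_le_finrank_a6Perp
    omega
  obtain ⟨l, hl, hFl⟩ := exists_supporting_functional hexp hne
  have hFD : F ⊆ Dprime := fun x hx => by
    rw [hFl] at hx
    exact hx.1
  have hspan_le : Submodule.span ℝ F ≤ a6Perp :=
    Submodule.span_le.2 fun x hx => (hFD hx).2
  obtain ⟨b, hbF, hbspan, hbli⟩ := exists_linearIndependent ℝ F
  have hbfin : b.Finite := hbli.setFinite
  have hbne : hbfin.toFinset.Nonempty := by
    rw [Set.Finite.toFinset_nonempty, Set.nonempty_iff_ne_empty]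
    rintro rfl
    rw [← hbspan, Submodule.span_empty, finrank_bot] at hrank
    have := two_le_finrank_a6Perp
    omega
  -- The sum of a basis of the span taken from `F` serves as a relative interior point: an
  -- inequality that is an equality at `x` is one at every basis vector, hence on all of `F`.
  obtain ⟨x, hx⟩ : ∃ x, x = ∑ v ∈ hbfin.toFinset, v := ⟨_, rfl⟩
  have hxF : x ∈ F := by
    rw [hx]
    refine Finset.sum_induction_nonempty (fun v => v) (fun v => v ∈ F) ?_ hbne
      fun v hv => hbF (hbfin.mem_toFinset.1 hv)
    intro u v hu hv
    rw [hFl] at hu hv ⊢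
    exact ⟨add_mem_Dprime hu.1 hv.1, by rw [map_add, hu.2, hv.2, add_zero]⟩
  have hxD := (mem_Dprime_iff x).1 (hFD hxF)
  obtain ⟨r, hr, hra, hxr⟩ : ∃ r, IsLeechRoot r ∧ r ∉ Set.range a6Root ∧ form x r = 0 := by
    by_contra! hcon
    -- If no wall passes through `x`, then `x` is interior to `D'`. The supporting functional,
    -- maximal there, vanishes on the whole space and `F` is all of `D'`, against the dimension.
    have hlz : ∀ v ∈ a6Perp, l v = 0 := by
      have hle : ∀ v ∈ a6Perp, l v ≤ 0 := fun v hv => by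
        have hev := eventually_mem_Dprime hxD.1 hxD.2.1 hv fun s hs => by
          by_cases hs' : s ∈ Set.range a6Root
          · obtain ⟨j, rfl⟩ := hs'
            exact Or.inr ⟨(mem_a6Perp_iff _).1 hxD.2.1 j, (mem_a6Perp_iff _).1 hv j⟩
          · exact Or.inl (lt_of_le_of_ne (hxD.2.2 s hs) (hcon s hs hs').symm)
        have hev' : ∀ᶠ s in 𝓝[>] (0 : ℝ), x + s • v ∈ Dprime := nhdsWithin_le_nhds hev
        obtain ⟨s, hs, hs0⟩ := (hev'.and self_mem_nhdsWithin).exists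
        have h1 := hl _ hs
        have h2 : l x = 0 := by
          rw [hFl] at hxF
          exact hxF.2
        rw [map_add, map_smul, h2, zero_add, smul_eq_mul] at h1
        exact nonpos_of_mul_nonpos_right h1 hs0
      intro v hv
      refine le_antisymm (hle v hv) ?_
      have := hle (-v) (a6Perp.neg_mem hv)
      rw [map_neg] at this
      linarith
    have hFeq : F = Dprime := by
      rw [hFl]
      ext y
      exact ⟨fun hy => hy.1, fun hy => ⟨hy, hlz y hy.2⟩⟩
    rw [hFeq, span_Dprime] at hrank
    omega
  have hrne : proj r ≠ 0 := fun h0 => by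
    have h1 := one_le_form_proj_weylVector hr hra
    rw [← form_proj_right (proj_mem _), h0, map_zero] at h1
    linarith
  have hneg : form (proj r) (proj r) < 0 :=
    form_neg_of_orthogonal hxD.1 (by rw [form_proj_right hxD.2.1, hxr]) hrne
  have hb0 : ∀ v ∈ b, form v r = 0 := by
    have hsum : ∑ v ∈ hbfin.toFinset, form v r = 0 := by
      rw [← hxr, hx, map_sum, LinearMap.sum_apply]
    have hz := (Finset.sum_eq_zero_iff_of_nonneg fun v hv =>
      ((mem_Dprime_iff v).1 (hFD (hbF (hbfin.mem_toFinset.1 hv)))).2.2 r hr).1 hsum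
    exact fun v hv => hz v (hbfin.mem_toFinset.2 hv)
  have hle : Submodule.span ℝ F ≤ wallSpan r := by
    rw [← hbspan]
    refine Submodule.span_le.2 fun v hv => ?_
    have hvp : v ∈ a6Perp := (hFD (hbF hv)).2
    exact ⟨hvp, (form_proj_right hvp r).trans (hb0 v hv)⟩
  -- Both spaces have codimension one, so `l` vanishes on the whole wall and `F` contains every
  -- point of `D'` on it.
  have hspan : Submodule.span ℝ F = wallSpan r :=
    Submodule.eq_of_le_of_finrank_eq hle (by
      have := finrank_wallSpan hneg.ne
      omega)
  refine ⟨r, hr, hneg, Set.Subset.antisymm (fun y hy => ?_) fun y hy => ?_⟩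
  · have hker : Submodule.span ℝ F ≤ LinearMap.ker l := Submodule.span_le.2 fun z hz => by
      rw [hFl] at hz
      exact hz.2
    rw [hFl]
    refine ⟨hy.1, hker ?_⟩
    rw [hspan]
    exact wallFace_subset r hy
  · exact ⟨hFD hy, (hle (Submodule.subset_span hy)).2⟩

lemma bijOn_faces :
    Set.BijOn (fun r : V => {x | x ∈ Dprime ∧ form x (proj r) = 0})
      {r : V | IsLeechRoot r ∧ IsRootLattice (withA6 r) ∧ Module.finrank ℤ (withA6 r) = 7}
      (faces Dprime) := by
  refine ⟨fun r hr => ?_, fun r hr s hs heq => ?_, fun F hF => ?_⟩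
  · exact wallFace_mem_faces hr.1 (form_proj_neg_of_isRootLattice hr.1 hr.2.1 hr.2.2)
  · exact wallFace_injective hr.1 (form_proj_neg_of_isRootLattice hr.1 hr.2.1 hr.2.2) hs.1
      (form_proj_neg_of_isRootLattice hs.1 hs.2.1 hs.2.2) heq
  · obtain ⟨r, hr, h, rfl⟩ := exists_wallFace_eq hF
    exact ⟨r, ⟨hr, isRootLattice_of_form_proj_neg hr h⟩, rfl⟩

end LeechA6

theorem mainTheorem2 :
    -- the four possible types
    (∀ r : V, IsLeechRoot r → IsRootLattice (withA6 r) → Module.finrank ℤ (withA6 r) = 7 →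
      HasRootType (withA6 r) cartanA6A1 ∨ HasRootType (withA6 r) (CartanMatrix.A 7) ∨
      HasRootType (withA6 r) (CartanMatrix.D 7) ∨ HasRootType (withA6 r) CartanMatrix.E₇) ∧
    -- the number of Leech roots of each type
    {r : V | IsLeechRoot r ∧ HasRootType (withA6 r) cartanA6A1}.ncard = 28 ∧
    {r : V | IsLeechRoot r ∧ HasRootType (withA6 r) (CartanMatrix.A 7)}.ncard = 14 ∧
    {r : V | IsLeechRoot r ∧ HasRootType (withA6 r) (CartanMatrix.D 7)}.ncard = 28 ∧
    {r : V | IsLeechRoot r ∧ HasRootType (withA6 r) CartanMatrix.E₇}.ncard = 56 ∧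
    -- they correspond bijectively to the faces of `D'`
    Set.BijOn (fun r : V => {x | x ∈ Dprime ∧ form x (proj r) = 0})
      {r : V | IsLeechRoot r ∧ IsRootLattice (withA6 r) ∧ Module.finrank ℤ (withA6 r) = 7}
      (faces Dprime) ∧
    -- the norms of the projections
    (∀ r : V, IsLeechRoot r →
      (HasRootType (withA6 r) cartanA6A1 → form (proj r) (proj r) = -2) ∧
      (HasRootType (withA6 r) (CartanMatrix.A 7) → form (proj r) (proj r) = -(8 / 7)) ∧
      (HasRootType (withA6 r) (CartanMatrix.D 7) → form (proj r) (proj r) = -(4 / 7)) ∧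
      (HasRootType (withA6 r) CartanMatrix.E₇ → form (proj r) (proj r) = -(2 / 7))) := by
  -- The norms are `-2 + d/7` for these values `d`; the mirror images give the same values.
  have h6 : dualNorm ![0, 0, 0, 0, 0, 0] = 0 ∧ dualNorm ![1, 0, 0, 0, 0, 0] = 6 ∧
      dualNorm ![0, 1, 0, 0, 0, 0] = 10 ∧ dualNorm ![0, 0, 1, 0, 0, 0] = 12 := by decide +kernel
  refine ⟨fun r hr hR hrank => hasRootType_of_form_proj_neg hr
    (form_proj_neg_of_isRootLattice hr hR hrank), ncard_A6A1, ncard_A7, ncard_D7, ncard_E7,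
    bijOn_faces, fun r hr => ⟨fun h => ?_, fun h => ?_, fun h => ?_, fun h => ?_⟩⟩
  · rw [form_proj_of_hasRootType hr isExtension_A6A1 h, h6.1]
    norm_num
  · rw [form_proj_of_hasRootType hr isExtension_A7_left h, h6.2.1]
    norm_num
  · rw [form_proj_of_hasRootType hr isExtension_D7_left h, h6.2.2.1]
    norm_num
  · rw [form_proj_of_hasRootType hr isExtension_E7_left h, h6.2.2.2]
    norm_num
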